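/- **Two-party Watson-Crick systems.** A deterministic two-party Watson-Crick system (DPWK) over a finite input alphabet $\Sigma$ with finite message set $M$ and endmarkers $\vartriangleright,\vartriangleleft\notin\Sigma$ consists of two components $A_i=\langle Q_i,\Sigma,\delta_i,\mu_i,q_{0,i},F_i\rangle$, $i\in\{1,2\}$, with finite state set $Q_i$, initial state $q_{0,i}\in Q_i$, accepting states $F_i\subseteq Q_i$, broadcast function $\mu_i:Q_i\times(\Sigma\cup\{\vartriangleright,\vartriangleleft\})\to M\cup\{\bot\}$ (where $\bot\notin M$ means "no message") and partial transition function $\delta_i:Q_i\times(\Sigma\cup\{\vartriangleright,\vartriangleleft\})\times(M\cup\{\bot\})\to Q_i\times\{0,1\}$. For an input $w=a_1\cdots a_n$, put $a_0=\vartriangleright$ and $a_{n+1}=\vartriangleleft$. A configuration on $w$ is a tuple $(p,i,q,j)$ with $p\in Q_1$, $q\in Q_2$, $0\le i,j\le n+1$ (states and head positions of the upper component $A_1$ and the lower component $A_2$). A step $(p,i,q,j)\vdash(p',i',q',j')$ between configurations takes place iff $\delta_1(p,a_i,\mu_2(q,a_j))=(p',d_1)$, $\delta_2(q,a_j,\mu_1(p,a_i))=(q',d_2)$,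 $i'=i+d_1$ and $j'=j-d_2$, for some $d_1,d_2$. The number of messages sent in this step is the number of values among $\mu_1(p,a_i),\mu_2(q,a_j)$ that differ from $\bot$. The initial configuration is $(q_{0,1},0,q_{0,2},n+1)$. A configuration without successor is halting. The word $w$ is accepted if the computation from the initial configuration reaches a halting configuration $(p,i,q,j)$ with $p\in F_1$ or $q\in F_2$; $L(\mathcal A)$ is the set of accepted words. **Reversibility.** A DPWK is *reversible* (a REV-PWK) if every configuration has at most one predecessor and there are (partial) reverse transition functions $\delta_i^{\leftarrow}:Q_i\times(\Sigma\cup\{\vartriangleright,\vartriangleleft\})\times(M\cup\{\bot\})\to Q_i\times\{0,1\}$ and reverse broadcast functions $\mu_i^{\leftarrow}:Q_i\times(\Sigma\cup\{\vartriangleright,\vartriangleleft\})\to M\cup\{\bot\}$ such that, for all inputs and all configurations, $(p,i,q,j)\vdash(p',i',q',j')$ if and only if $\delta_1^{\leftarrow}(p',a_i,\mu_2^{\leftarrow}(q',a_j))=(p,d_1)$, $\delta_2^{\leftarrow}(q',a_j,\mu_1^{\leftarrow}(p',a_i))=(q,d_2)$, $i=i'-d_1$ and $j=j'+d_2$ for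 some $d_1,d_2$ (in a reverse step the heads are moved first, and then the symbols are read). The number of messages sent in this reverse step is the number of values among $\mu_1^{\leftarrow}(p',a_i),\mu_2^{\leftarrow}(q',a_j)$ that differ from $\bot$. For $k\ge 0$, let $\mathrm{REV\text{-}PWK}(k)$ be the class of those REV-PWKs for which reverse functions as above can be chosen such that, for each accepted word, at most $k$ messages in total are sent in the accepting computation, and at most $k$ messages in total are sent in the reverse computation from the halting configuration back to the initial one. **Theorem.** Let $k\ge 0$ be a constant. Then emptiness, finiteness, inclusion and equivalence are decidable for $\mathrm{REV\text{-}PWK}(k)$. That is, for each of the following questions there is an algorithm (a total computable function on finite descriptions of systems, namely the alphabet and the tables of both components) that answers it correctly whenever the given systems belong to $\mathrm{REV\text{-}PWK}(k)$: 1. given $\mathcal A$, is $L(\mathcal A)=\emptyset$? 2. given $\mathcal A$, is $L(\mathcal A)$ finite? 3. given $\mathcal A$ and $\mathcal B$, possibly over different alphabets, is $L(\mathcal A)\subseteq L(\mathcal B)$? 4. given $\mathcal A$ and $\mathcal B$, possibly over different alphabets, is $L(\mathcal A)=L(\mathcal B)$? -/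

import Mathlib

namespace WatsonCrick

/-- Contents of a tape square: an endmarker or an input symbol from `Γ`. -/
inductive TapeSymbol (Γ : Type) where
  | leftEnd : TapeSymbol Γ
  | rightEnd : TapeSymbol Γ
  | letter : Γ → TapeSymbol Γ

/-- `stay` is the move `0`.  `advance` is `+` in a forward transition function and `-` in a reverse
transition function; in which direction the head then goes depends on the component. -/
inductive Move where
  | stay : Move
  | advance : Move

/-- Number of squares by which the head is displaced. -/
def Move.dist : Move → ℕ
  | stay => 0
  | advance => 1

/-- A partial transition function together with a broadcast function. `none : Option M` is the
value `⊥` (nothing to send / nothing received), and `trans q x m = none` means that the transition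
function is undefined. The same type of data serves for the reverse functions of a component. -/
structure Dynamics (Γ M Q : Type) where
  broadcast : Q → TapeSymbol Γ → Option M
  trans : Q → TapeSymbol Γ → Option M → Option (Q × Move)

/-- A component of a two-party Watson-Crick system. -/
structure Component (Γ M Q : Type) extends Dynamics Γ M Q where
  start : Q
  accept : Finset Q

/-- A deterministic two-party Watson-Crick system (DPWK) with input symbols `Γ`, messages `M`
and state sets `Q₁`, `Q₂`. -/
structure DPWK (Γ M Q₁ Q₂ : Type) where
  upper : Component Γ M Q₁
  lower : Component Γ M Q₂

/-- The tape inscription `⊳ a₁ ⋯ aₙ ⊲`; the squares are numbered `0, …, n + 1`. -/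
def tape {Γ : Type} (w : List Γ) : List (TapeSymbol Γ) :=
  TapeSymbol.leftEnd :: (w.map TapeSymbol.letter ++ [TapeSymbol.rightEnd])

/-- States and head positions of the upper component (`state₁`, `pos₁`) and of the lower component
(`state₂`, `pos₂`). -/
structure Config (Q₁ Q₂ : Type) where
  state₁ : Q₁
  pos₁ : ℕ
  state₂ : Q₂
  pos₂ : ℕ

/-- `1` for a message and `0` for `⊥`. -/
def messageCount {M : Type} : Option M → ℕ
  | none => 0
  | some _ => 1

namespace DPWK

variable {Γ M Q₁ Q₂ : Type}

/-- One forward step `c ⊢ c'` on input `w`, during which `m` messages are sent. Both components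
read the squares that their heads scan in `c`, broadcast, and change state; the head of the
upper component moves to the right and the head of the lower component moves to the left. Both
heads have to be on the tape before and after the step. -/
def StepWith (A : DPWK Γ M Q₁ Q₂) (w : List Γ) (c c' : Config Q₁ Q₂) (m : ℕ) : Prop :=
  ∃ (x y : TapeSymbol Γ) (d₁ d₂ : Move),
    (tape w)[c.pos₁]? = some x ∧ (tape w)[c.pos₂]? = some y ∧
    A.upper.trans c.state₁ x (A.lower.broadcast c.state₂ y) = some (c'.state₁, d₁) ∧
    A.lower.trans c.state₂ y (A.upper.broadcast c.state₁ x) = some (c'.state₂, d₂) ∧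
    c'.pos₁ = c.pos₁ + d₁.dist ∧ c.pos₂ = c'.pos₂ + d₂.dist ∧
    c'.pos₁ < (tape w).length ∧ c'.pos₂ < (tape w).length ∧
    m = messageCount (A.upper.broadcast c.state₁ x) + messageCount (A.lower.broadcast c.state₂ y)

/-- `c ⊢ c'` on input `w`. -/
def Step (A : DPWK Γ M Q₁ Q₂) (w : List Γ) (c c' : Config Q₁ Q₂) : Prop :=
  ∃ m, A.StepWith w c c' m

/-- `c ⊢* c'` on input `w`, with `m` messages sent in total. -/
inductive Run (A : DPWK Γ M Q₁ Q₂) (w : List Γ) : Config Q₁ Q₂ → Config Q₁ Q₂ → ℕ → Prop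
  | refl (c : Config Q₁ Q₂) : Run A w c c 0
  | cons {c c' c'' : Config Q₁ Q₂} {m n : ℕ} :
      A.StepWith w c c' m → Run A w c' c'' n → Run A w c c'' (m + n)

/-- The upper component scans the left endmarker and the lower one the right endmarker. -/
def initial (A : DPWK Γ M Q₁ Q₂) (w : List Γ) : Config Q₁ Q₂ :=
  ⟨A.upper.start, 0, A.lower.start, w.length + 1⟩

def Halts (A : DPWK Γ M Q₁ Q₂) (w : List Γ) (c : Config Q₁ Q₂) : Prop :=
  ∀ c', ¬ A.Step w c c'

/-- `c` is a halting configuration in which at least one component is in an accepting state. -/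
def AcceptingHalt (A : DPWK Γ M Q₁ Q₂) (w : List Γ) (c : Config Q₁ Q₂) : Prop :=
  A.Halts w c ∧ (c.state₁ ∈ A.upper.accept ∨ c.state₂ ∈ A.lower.accept)

/-- The accepted language. -/
def language (A : DPWK Γ M Q₁ Q₂) : Set (List Γ) :=
  {w | ∃ c m, A.Run w (A.initial w) c m ∧ A.AcceptingHalt w c}

end DPWK

/-- Reverse transition and reverse broadcast functions for both components. -/
structure ReverseFunctions (Γ M Q₁ Q₂ : Type) where
  upper : Dynamics Γ M Q₁
  lower : Dynamics Γ M Q₂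

namespace ReverseFunctions

variable {Γ M Q₁ Q₂ : Type}

/-- One backward step from `c'` to `c` on input `w`, during which `m` messages are sent.
First the heads are moved to their positions in `c` (the upper one to the left, the lower one to
the right), and then the symbols are read there. -/
def StepWith (R : ReverseFunctions Γ M Q₁ Q₂) (w : List Γ) (c' c : Config Q₁ Q₂) (m : ℕ) : Prop :=
  ∃ (x y : TapeSymbol Γ) (d₁ d₂ : Move),
    (tape w)[c.pos₁]? = some x ∧ (tape w)[c.pos₂]? = some y ∧
    R.upper.trans c'.state₁ x (R.lower.broadcast c'.state₂ y) = some (c.state₁, d₁) ∧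
    R.lower.trans c'.state₂ y (R.upper.broadcast c'.state₁ x) = some (c.state₂, d₂) ∧
    c'.pos₁ = c.pos₁ + d₁.dist ∧ c.pos₂ = c'.pos₂ + d₂.dist ∧
    c'.pos₁ < (tape w).length ∧ c'.pos₂ < (tape w).length ∧
    m = messageCount (R.upper.broadcast c'.state₁ x) + messageCount (R.lower.broadcast c'.state₂ y)

/-- One backward step from `c'` to `c`. -/
def Step (R : ReverseFunctions Γ M Q₁ Q₂) (w : List Γ) (c' c : Config Q₁ Q₂) : Prop :=
  ∃ m, R.StepWith w c' c m

/-- A reverse computation from `c` to `c'` with `m` messages sent in total. -/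
inductive Run (R : ReverseFunctions Γ M Q₁ Q₂) (w : List Γ) :
    Config Q₁ Q₂ → Config Q₁ Q₂ → ℕ → Prop
  | refl (c : Config Q₁ Q₂) : Run R w c c 0
  | cons {c c' c'' : Config Q₁ Q₂} {m n : ℕ} :
      R.StepWith w c c' m → Run R w c' c'' n → Run R w c c'' (m + n)

/-- The backward step relation of `R` is the inverse of the forward step relation of `A`. -/
def Reverses (R : ReverseFunctions Γ M Q₁ Q₂) (A : DPWK Γ M Q₁ Q₂) : Prop :=
  ∀ (w : List Γ) (c c' : Config Q₁ Q₂), R.Step w c' c ↔ A.Step w c c'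

end ReverseFunctions

namespace DPWK

variable {Γ M Q₁ Q₂ : Type}

/-- Every configuration has at most one predecessor. -/
def BackwardDeterministic (A : DPWK Γ M Q₁ Q₂) : Prop :=
  ∀ (w : List Γ) (c₁ c₂ c' : Config Q₁ Q₂), A.Step w c₁ c' → A.Step w c₂ c' → c₁ = c₂

/-- `A` is a reversible two-party Watson-Crick system (REV-PWK): every configuration has at most
one predecessor, and predecessors are computed by reverse functions. -/
def Reversible (A : DPWK Γ M Q₁ Q₂) : Prop :=
  A.BackwardDeterministic ∧ ∃ R : ReverseFunctions Γ M Q₁ Q₂, R.Reverses A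

/-- `A` is a REV-PWK that is communication bounded by `f`: every accepted word `w` is accepted by
a computation in which, and in whose reverse computation (from the halting configuration back to
the initial one), at most `f |w|` messages are sent. -/
def IsRevPWK (f : ℕ → ℕ) (A : DPWK Γ M Q₁ Q₂) : Prop :=
  A.BackwardDeterministic ∧
  ∃ R : ReverseFunctions Γ M Q₁ Q₂, R.Reverses A ∧
    ∀ w ∈ A.language, ∃ (c : Config Q₁ Q₂) (m n : ℕ),
      A.Run w (A.initial w) c m ∧ A.AcceptingHalt w c ∧ m ≤ f w.length ∧
      R.Run w c (A.initial w) n ∧ n ≤ f w.length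

/-- Communication bounded systems are in particular reversible. -/
theorem IsRevPWK.reversible {f : ℕ → ℕ} {A : DPWK Γ M Q₁ Q₂} (h : A.IsRevPWK f) :
    A.Reversible :=
  ⟨h.1, h.2.imp fun _ hR => hR.1⟩

end DPWK

/-- A DPWK whose input symbols form a finite set of natural numbers, and whose messages and states
are numbered. Up to the names of symbols, messages and states, every DPWK is of this form. -/
structure System where
  alphabet : Finset ℕ
  numMessages : ℕ
  numStates₁ : ℕ
  numStates₂ : ℕ
  dpwk : DPWK {a // a ∈ alphabet} (Fin numMessages) (Fin numStates₁) (Fin numStates₂)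

/-- The number of states, the initial state, the accepting states, and the value tables of the
broadcast function and of the transition function. -/
abbrev ComponentCode : Type :=
  ℕ × ℕ × List ℕ × List ((ℕ × ℕ) × Option ℕ) × List ((ℕ × ℕ × Option ℕ) × Option (ℕ × ℕ))

/-- The alphabet, the number of messages, and the two components. -/
abbrev SystemCode : Type := List ℕ × ℕ × ComponentCode × ComponentCode

def TapeSymbol.code {S : Finset ℕ} : TapeSymbol {a // a ∈ S} → ℕ
  | leftEnd => 0
  | rightEnd => 1
  | letter a => a.1 + 2

/-- All tape symbols over the alphabet `S`. -/
def tapeSymbols (S : Finset ℕ) : List (TapeSymbol {a // a ∈ S}) :=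
  TapeSymbol.leftEnd :: TapeSymbol.rightEnd :: (S.attach.sort (· ≤ ·)).map TapeSymbol.letter

/-- All elements of `M ∪ {⊥}`. -/
def messageList (m : ℕ) : List (Option (Fin m)) := none :: (List.finRange m).map some

def Component.code {S : Finset ℕ} {m n : ℕ} (A : Component {a // a ∈ S} (Fin m) (Fin n)) :
    ComponentCode :=
  (n, A.start.val, (A.accept.sort (· ≤ ·)).map Fin.val,
    (List.finRange n ×ˢ tapeSymbols S).map
      fun (q, x) => ((q.val, x.code), (A.broadcast q x).map Fin.val),
    (List.finRange n ×ˢ tapeSymbols S ×ˢ messageList m).map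
      fun (q, x, r) => ((q.val, x.code, r.map Fin.val),
        (A.trans q x r).map fun (q', d) => (q'.val, d.dist)))

namespace System

/-- The finite description of a system that is handed to a decision procedure. -/
def code (A : System) : SystemCode :=
  (A.alphabet.sort (· ≤ ·), A.numMessages, A.dpwk.upper.code, A.dpwk.lower.code)

/-- The accepted language, as a set of words of natural numbers, so that the languages of systems
over different alphabets can be compared. -/
def language (A : System) : Set (List ℕ) :=
  {w | ∃ v ∈ A.dpwk.language, w = v.map Subtype.val}

/-- The class of REV-PWKs that are communication bounded by `f`. -/
def revPWK (f : ℕ → ℕ) : Set System := {A | A.dpwk.IsRevPWK f}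

/-- The property `P` is decidable for the systems in `C`: some total computable function, applied
to the description of a system in `C`, tells whether the system has the property. -/
def DecidableFor (C : Set System) (P : System → Prop) : Prop :=
  ∃ f : SystemCode → Bool, Computable f ∧ ∀ A ∈ C, (f A.code = true ↔ P A)

/-- The relation `P` is decidable for pairs of systems in `C`. -/
def DecidableFor₂ (C : Set System) (P : System → System → Prop) : Prop :=
  ∃ f : SystemCode × SystemCode → Bool, Computable f ∧
    ∀ A ∈ C, ∀ B ∈ C, (f (A.code, B.code) = true ↔ P A B)

end System

end WatsonCrick

/-!
# Decision problems for two-party Watson-Crick systems with boundedly many messages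

Run the two components of a system separately, each as a nondeterministic one-way machine that
guesses what the other component does. If at most `K` messages are sent, the guesses concern only
the at most `K` situations in which a message is sent. Two such one-way runs fit together to a run
of the system exactly if both components take the same number of steps between consecutive
messages and have guessed the same situations. Both conditions are equalities of finitely many
numbers that are sums of bounded contributions of the single steps, so they say that two weight
vectors of dimension `2 * (K + 1)` agree (`DPWK.exists_run_of_reads`, `DPWK.exists_reads_of_run`).
As the lower component reads the tape from right to left, its automaton is reversed, and the
product of both automata, with the difference of the weights, accepts with weight zero the words on
which a given situation is reached after a given number of messages (`DPWK.covered_reach`).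

Whether a word is accepted can be read off from one situation that the computation reaches. For
rejection this uses determinism: a computation sends too many messages, halts without accepting,
or ends in a loop in which no message is sent and no head moves
(`DPWK.exists_reach_of_notMem_language`). Hence the language and its complement are both unions of
languages of such automata, whose size is bounded in terms of the description (`Covered`).

A long accepting walk of weight zero is a short walk with many short cycles attached. By
`exists_zero_sum`, more than a computable number of bounded integer vectors with a bounded sum have
a nonempty subfamily with sum zero, so some of the cycles can be dropped or repeated without
changing the total weight (`Walk.pump`). This bounds the length of a shortest word of a nonempty
language, of a word that witnesses infinity, and of a shortest word in the difference of two
languages (`System.language_eq_empty_iff`, `System.finite_language_iff`,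
`System.language_subset_iff`). The bounds are primitive recursive in the descriptions, and so is the
simulation of a system on a given word (`System.primrecRel_acceptsCode`); each question is decided
by testing all words up to the bound. Equality is inclusion in both directions.
-/

/-! ### Zero-sum submultisets of bounded integer vectors -/

namespace WatsonCrick

/-- If a multiset has more than `C * C` elements with values of `f` in `[1, C]`, some value occurs
more than `C` times. -/
theorem exists_card_filter_eq_gt {X : Type} (s : Multiset X) (f : X → ℕ) (C : ℕ)
    (hpos : ∀ x ∈ s, 1 ≤ f x) (hC : ∀ x ∈ s, f x ≤ C) (hs : C * C < s.card) :
    ∃ p, 1 ≤ p ∧ p ≤ C ∧ C < (s.filter fun x => f x = p).card := by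
  classical
  by_contra! h
  have h1 : s.card = ∑ p ∈ Finset.Icc 1 C, (s.filter fun x => f x = p).card := by
    have : (s.map f).card = ∑ p ∈ Finset.Icc 1 C, (s.map f).count p := by
      rw [Multiset.sum_count_eq_card]
      intro a ha
      obtain ⟨x, hx, rfl⟩ := Multiset.mem_map.1 ha
      exact Finset.mem_Icc.2 ⟨hpos x hx, hC x hx⟩
    rw [Multiset.card_map] at this
    rw [this]
    refine Finset.sum_congr rfl fun p _ => ?_
    rw [Multiset.count_map]
    congr 1
    exact Multiset.filter_congr fun x _ => eq_comm
  have h2 : s.card ≤ ∑ p ∈ Finset.Icc 1 C, C := by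
    rw [h1]
    refine Finset.sum_le_sum fun p hp => ?_
    rw [Finset.mem_Icc] at hp
    exact h p hp.1 hp.2
  simp at h2
  omega

theorem card_le_sum_of_pos {X : Type} (s : Multiset X) (f : X → ℤ) (h : ∀ x ∈ s, 1 ≤ f x) :
    (s.card : ℤ) ≤ (s.map f).sum := by
  induction s using Multiset.induction_on with
  | empty => simp
  | cons a s ih =>
    have h1 := h a (Multiset.mem_cons_self a s)
    have h2 := ih fun x hx => h x (Multiset.mem_cons_of_mem hx)
    simp only [Multiset.card_cons, Multiset.map_cons, Multiset.sum_cons]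
    push_cast
    linarith

theorem sum_le_card_mul {X : Type} (s : Multiset X) (f : X → ℤ) (C : ℤ) (h : ∀ x ∈ s, f x ≤ C) :
    (s.map f).sum ≤ s.card * C := by
  induction s using Multiset.induction_on with
  | empty => simp
  | cons a s ih =>
    have h1 := h a (Multiset.mem_cons_self a s)
    have h2 := ih fun x hx => h x (Multiset.mem_cons_of_mem hx)
    simp only [Multiset.card_cons, Multiset.map_cons, Multiset.sum_cons]
    push_cast
    linarith

theorem abs_sum_le_card_mul {X : Type} (s : Multiset X) (f : X → ℤ) (C : ℤ)
    (h : ∀ x ∈ s, |f x| ≤ C) : |(s.map f).sum| ≤ s.card * C := by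
  have h1 := sum_le_card_mul s f C fun x hx => (abs_le.1 (h x hx)).2
  have h2 := sum_le_card_mul s (fun x => - f x) C fun x hx => by
    have := (abs_le.1 (h x hx)).1
    linarith
  rw [Multiset.sum_map_neg] at h2
  rw [abs_le]
  constructor <;> linarith

theorem sum_map_eq_card_mul {X : Type} (s : Multiset X) (f : X → ℤ) (a : ℤ)
    (h : ∀ x ∈ s, f x = a) : (s.map f).sum = s.card * a := by
  rw [Multiset.map_congr rfl h]
  simp

theorem exists_le_card_eq {X : Type} (s : Multiset X) (n : ℕ) (h : n ≤ s.card) :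
    ∃ t ≤ s, t.card = n := by
  induction s using Quotient.inductionOn with
  | _ l => exact ⟨(l.take n : List X), (List.take_sublist n l).subperm, by simpa using h⟩

/-- The one-dimensional case: with many integers of either sign, `q` copies of some `p > 0` cancel
`p` copies of some `-q < 0`. -/
theorem exists_small_zero_sum {X : Type} (s : Multiset X) (f : X → ℤ) (C : ℕ)
    (hf : ∀ x ∈ s, |f x| ≤ C) (hsum : |(s.map f).sum| ≤ C) (hs : C + C * C + C * C * C < s.card) :
    ∃ t ≤ s, t ≠ 0 ∧ t.card ≤ 2 * C + 1 ∧ (t.map f).sum = 0 := by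
  classical
  by_cases hz : ∃ x ∈ s, f x = 0
  · obtain ⟨x, hx, h0⟩ := hz
    exact ⟨{x}, Multiset.singleton_le.2 hx, by simp, by simp, by simpa⟩
  push Not at hz
  set P := s.filter fun x => 0 < f x with hP
  set N := s.filter fun x => ¬ 0 < f x with hN
  have hPN : P + N = s := Multiset.filter_add_not _ s
  have hcard : (P.card : ℤ) + N.card = s.card := by
    rw [← hPN]; simp
  have hsums : (P.map f).sum + (N.map f).sum = (s.map f).sum := by
    rw [← hPN]; simp
  have hPm : ∀ x ∈ P, 1 ≤ f x ∧ f x ≤ C := fun x hx => by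
    rw [hP, Multiset.mem_filter] at hx
    exact ⟨hx.2, (abs_le.1 (hf x hx.1)).2⟩
  have hNm : ∀ x ∈ N, 1 ≤ - f x ∧ - f x ≤ C := fun x hx => by
    rw [hN, Multiset.mem_filter] at hx
    have := hz x hx.1
    have := (abs_le.1 (hf x hx.1)).1
    constructor <;> omega
  have hP1 := card_le_sum_of_pos P f fun x hx => (hPm x hx).1
  have hP2 := sum_le_card_mul P f C fun x hx => (hPm x hx).2
  have hN1 := card_le_sum_of_pos N (fun x => - f x) fun x hx => (hNm x hx).1
  have hN2 := sum_le_card_mul N (fun x => - f x) C fun x hx => (hNm x hx).2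
  rw [Multiset.sum_map_neg] at hN1 hN2
  obtain ⟨hl, hu⟩ := abs_le.1 hsum
  have hs' : (C : ℤ) + C * C + C * C * C < s.card := by exact_mod_cast hs
  have hC0 : (0 : ℤ) ≤ C := Int.natCast_nonneg C
  have hPbig : C * C < P.card := by
    by_contra! hle
    have hle' : (P.card : ℤ) ≤ C * C := by exact_mod_cast hle
    nlinarith
  have hNbig : C * C < N.card := by
    by_contra! hle
    have hle' : (N.card : ℤ) ≤ C * C := by exact_mod_cast hle
    nlinarith
  obtain ⟨p, hp1, hpC, hp⟩ := exists_card_filter_eq_gt P (fun x => (f x).toNat) C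
    (fun x hx => by have := hPm x hx; omega) (fun x hx => by have := hPm x hx; omega) hPbig
  obtain ⟨q, hq1, hqC, hq⟩ := exists_card_filter_eq_gt N (fun x => (- f x).toNat) C
    (fun x hx => by have := hNm x hx; omega) (fun x hx => by have := hNm x hx; omega) hNbig
  obtain ⟨t₁, ht₁, hc₁⟩ := exists_le_card_eq (P.filter fun x => (f x).toNat = p) q (by omega)
  obtain ⟨t₂, ht₂, hc₂⟩ := exists_le_card_eq (N.filter fun x => (- f x).toNat = q) p (by omega)
  refine ⟨t₁ + t₂, ?_, ?_, ?_, ?_⟩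
  · rw [← hPN]
    exact add_le_add (ht₁.trans (Multiset.filter_le _ _)) (ht₂.trans (Multiset.filter_le _ _))
  · intro h0
    have := congrArg Multiset.card h0
    simp at this
    have h1 : t₁.card = 0 := by rw [this.1]; rfl
    omega
  · simp; omega
  · have e₁ := sum_map_eq_card_mul t₁ f p fun x hx => by
      have := Multiset.mem_filter.1 (Multiset.mem_of_le ht₁ hx)
      have := hPm x this.1
      omega
    have e₂ := sum_map_eq_card_mul t₂ f (-q) fun x hx => by
      have := Multiset.mem_filter.1 (Multiset.mem_of_le ht₂ hx)
      have := hNm x this.1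
      omega
    rw [Multiset.map_add, Multiset.sum_add, e₁, e₂, hc₁, hc₂]
    ring

/-- Number of elements left over when small zero-sum blocks are split off greedily. -/
def leftoverBound (C : ℕ) : ℕ := C + C * C + C * C * C

/-- A multiset with bounded values and bounded sum splits into small zero-sum blocks and few
remaining elements. -/
theorem exists_zero_sum_blocks {X : Type} (f : X → ℤ) (C : ℕ) (s : Multiset X)
    (hf : ∀ x ∈ s, |f x| ≤ C) (hsum : |(s.map f).sum| ≤ C) :
    ∃ (B : Multiset (Multiset X)) (r : Multiset X), s = B.join + r ∧
      (∀ b ∈ B, b ≠ 0 ∧ b.card ≤ 2 * C + 1 ∧ (b.map f).sum = 0) ∧ r.card ≤ leftoverBound C := by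
  classical
  induction h : s.card using Nat.strong_induction_on generalizing s with
  | _ n ih =>
  subst h
  by_cases hs : s.card ≤ leftoverBound C
  · exact ⟨0, s, by simp, by simp, hs⟩
  obtain ⟨t, hts, ht0, htC, htsum⟩ := exists_small_zero_sum s f C hf hsum (not_le.1 hs)
  obtain ⟨u, rfl⟩ := Multiset.le_iff_exists_add.1 hts
  have hu : (u.map f).sum = ((t + u).map f).sum := by simp [htsum]
  have htpos := Multiset.card_pos.2 ht0
  obtain ⟨B, r, hB, hb, hr⟩ := ih u.card (by simp; omega) u
    (fun x hx => hf x (Multiset.mem_add.2 (Or.inr hx))) (by rwa [hu]) rfl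
  refine ⟨t ::ₘ B, r, by rw [Multiset.join_cons, add_assoc, ← hB], ?_, hr⟩
  intro b hbm
  rcases Multiset.mem_cons.1 hbm with rfl | hbm
  · exact ⟨ht0, htC, htsum⟩
  · exact hb b hbm

/-- More than `zeroSumBound d C` integer vectors of dimension `d` with entries bounded by `C`, and
with a sum whose entries are bounded by `C`, have a nonempty subfamily with sum zero. -/
def zeroSumBound : ℕ → ℕ → ℕ
  | 0, _ => 0
  | d + 1, C => leftoverBound C +
      (2 * C + 1) * zeroSumBound d ((2 * C + 1) * C + C + leftoverBound C * C)

theorem sum_map_join {X : Type} (B : Multiset (Multiset X)) (f : X → ℤ) :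
    (B.join.map f).sum = (B.map fun b => (b.map f).sum).sum := by
  rw [Multiset.map_join, Multiset.sum_join, Multiset.map_map]
  rfl

theorem card_join_le {X : Type} (B : Multiset (Multiset X)) (k : ℕ) (h : ∀ b ∈ B, b.card ≤ k) :
    B.join.card ≤ B.card * k := by
  rw [Multiset.card_join, ← Multiset.card_map Multiset.card B, ← smul_eq_mul]
  refine Multiset.sum_le_card_nsmul _ _ fun x hx => ?_
  obtain ⟨b, hb, rfl⟩ := Multiset.mem_map.1 hx
  exact h b hb

/-- Coordinates are made zero one at a time: the blocks that vanish in one coordinate are the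
elements of the multiset to which the induction hypothesis is applied. -/
theorem exists_zero_sum {ι : Type} (I : Finset ι) : ∀ {X : Type} (f : X → ι → ℤ) (C : ℕ)
    (s : Multiset X), (∀ x ∈ s, ∀ i ∈ I, |f x i| ≤ C) →
    (∀ i ∈ I, |(s.map fun x => f x i).sum| ≤ C) → zeroSumBound I.card C < s.card →
    ∃ t ≤ s, t ≠ 0 ∧ ∀ i ∈ I, (t.map fun x => f x i).sum = 0 := by
  classical
  induction I using Finset.induction_on with
  | empty =>
    intro X f C s _ _ hs
    exact ⟨s, le_rfl, Multiset.card_pos.1 (by omega), by simp⟩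
  | insert i I hi ih =>
    intro X f C s hf hsum hs
    obtain ⟨B, r, hsB, hB, hr⟩ := exists_zero_sum_blocks (fun x => f x i) C s
      (fun x hx => hf x hx i (Finset.mem_insert_self i I)) (hsum i (Finset.mem_insert_self i I))
    rw [Finset.card_insert_of_notMem hi, zeroSumBound] at hs
    set D := (2 * C + 1) * C + C + leftoverBound C * C with hD
    have hjoin := card_join_le B (2 * C + 1) fun b hb => (hB b hb).2.1
    have hcard : s.card = B.join.card + r.card := by rw [hsB, Multiset.card_add]
    have hBcard : zeroSumBound I.card D < B.card := by
      by_contra! hle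
      have := Nat.mul_le_mul_left (2 * C + 1) hle
      rw [mul_comm] at hjoin
      omega
    have hBs : ∀ b ∈ B, b ≤ s := fun b hb => by
      rw [hsB]
      obtain ⟨B', rfl⟩ := Multiset.exists_cons_of_mem hb
      rw [Multiset.join_cons, add_assoc]
      exact Multiset.le_add_right _ _
    obtain ⟨T, hTB, hT0, hT⟩ := ih (fun (b : Multiset X) j => (b.map fun x => f x j).sum) D B
      (fun b hb j hj => by
        have h1 := abs_sum_le_card_mul b (fun x => f x j) C fun x hx =>
          hf x (Multiset.mem_of_le (hBs b hb) hx) j (Finset.mem_insert_of_mem hj)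
        have h2 := Nat.mul_le_mul_right C (hB b hb).2.1
        have h3 : ((b.card * C : ℕ) : ℤ) ≤ (D : ℕ) := by
          exact_mod_cast h2.trans (by omega)
        push_cast at h3
        exact h1.trans h3)
      (fun j hj => by
        rw [← sum_map_join B fun x => f x j]
        have h1 := abs_sum_le_card_mul r (fun x => f x j) C fun x hx =>
          hf x (by rw [hsB]; exact Multiset.mem_add.2 (Or.inr hx)) j (Finset.mem_insert_of_mem hj)
        have h2 := Nat.mul_le_mul_right C hr
        have h3 : ((r.card * C + C : ℕ) : ℤ) ≤ (D : ℕ) := by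
          exact_mod_cast (by omega)
        push_cast at h3
        have h4 := hsum j (Finset.mem_insert_of_mem hj)
        rw [hsB, Multiset.map_add, Multiset.sum_add] at h4
        rw [abs_le] at h1 h4 ⊢
        constructor <;> linarith [h1.1, h1.2, h4.1, h4.2])
      hBcard
    obtain ⟨U, rfl⟩ := Multiset.le_iff_exists_add.1 hTB
    refine ⟨T.join, ?_, ?_, ?_⟩
    · rw [hsB, Multiset.join_add, add_assoc]
      exact Multiset.le_add_right _ _
    · obtain ⟨b, hb⟩ := Multiset.exists_mem_of_ne_zero hT0
      obtain ⟨T', rfl⟩ := Multiset.exists_cons_of_mem hb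
      have := (hB b (Multiset.mem_add.2 (Or.inl hb))).1
      intro h0
      rw [Multiset.join_cons] at h0
      exact this (add_eq_zero.1 h0).1
    · intro j hj
      rw [sum_map_join T fun x => f x j]
      rcases Finset.mem_insert.1 hj with rfl | hj
      · refine Multiset.sum_eq_zero fun x hx => ?_
        obtain ⟨b, hb, rfl⟩ := Multiset.mem_map.1 hx
        exact (hB b (Multiset.mem_add.2 (Or.inl hb))).2.2
      · exact hT j hj

end WatsonCrick

/-! ### Walks in finite weighted digraphs -/

namespace WatsonCrick

/-- `Walk E u l a t`: there is a walk from `u` to `t` along edges of `E` that visits the vertices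
of the list `l` (which begins with `u` and ends with `t`) and has total cost `a`. -/
inductive Walk {V A : Type} [AddCommMonoid A] (E : V → A → V → Prop) : V → List V → A → V → Prop
  | nil (v : V) : Walk E v [v] 0 v
  | cons {u v t : V} {l : List V} {a b : A} :
      E u a v → Walk E v l b t → Walk E u (u :: l) (a + b) t

namespace Walk

variable {V A : Type} [AddCommMonoid A] {E : V → A → V → Prop}

theorem split {l₁ l₂ : List V} {u v t : V} {a : A} (h : Walk E u (l₁ ++ v :: l₂) a t) :
    ∃ a₁ a₂, Walk E u (l₁ ++ [v]) a₁ v ∧ Walk E v (v :: l₂) a₂ t ∧ a = a₁ + a₂ := by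
  induction l₁ generalizing u a with
  | nil =>
    have hu : u = v := by cases h <;> rfl
    subst hu
    exact ⟨0, a, .nil u, h, (zero_add a).symm⟩
  | cons x l₁ ih =>
    generalize hl : x :: l₁ ++ v :: l₂ = l at h
    cases h with
    | nil => simp at hl
    | cons he hw =>
      simp only [List.cons_append, List.cons.injEq] at hl
      obtain ⟨rfl, rfl⟩ := hl
      obtain ⟨a₁, a₂, h₁, h₂, rfl⟩ := ih hw
      exact ⟨_, a₂, .cons he h₁, h₂, (add_assoc _ _ _).symm⟩

theorem append {l₁ l₂ : List V} {u v t : V} {a₁ a₂ : A} (h₁ : Walk E u (l₁ ++ [v]) a₁ v)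
    (h₂ : Walk E v l₂ a₂ t) : Walk E u (l₁ ++ l₂) (a₁ + a₂) t := by
  induction l₁ generalizing u a₁ with
  | nil =>
    generalize hl : [] ++ [v] = l at h₁
    cases h₁ with
    | nil => simpa using h₂
    | cons _ hw =>
      simp only [List.nil_append, List.cons.injEq] at hl
      obtain ⟨_, rfl⟩ := hl
      cases hw
  | cons x l₁ ih =>
    generalize hl : x :: l₁ ++ [v] = l at h₁
    cases h₁ with
    | nil => simp at hl
    | cons he hw =>
      simp only [List.cons_append, List.cons.injEq] at hl
      obtain ⟨rfl, rfl⟩ := hl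
      rw [add_assoc]
      exact .cons he (ih hw)

theorem eq_append_singleton {l : List V} {u t : V} {a : A} (h : Walk E u l a t) :
    ∃ l', l = l' ++ [t] := by
  induction h with
  | nil v => exact ⟨[], rfl⟩
  | cons _ _ ih =>
    obtain ⟨l', rfl⟩ := ih
    exact ⟨_ :: l', rfl⟩

/-- Closed walks attached to vertices of a walk can be inserted into it. -/
theorem insert_cycles {l : List V} {u t : V} {a : A} (h : Walk E u l a t) (s : Multiset A)
    (hs : ∀ c ∈ s, ∃ v ∈ l, ∃ k, Walk E v k c v) :
    ∃ k, l ⊆ k ∧ Walk E u k (a + s.sum) t := by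
  induction s using Multiset.induction_on with
  | empty => exact ⟨l, List.Subset.refl l, by simpa using h⟩
  | cons c s ih =>
    obtain ⟨k, hlk, hk⟩ := ih fun c hc => hs c (Multiset.mem_cons_of_mem hc)
    obtain ⟨v, hv, k', hk'⟩ := hs c (Multiset.mem_cons_self c s)
    obtain ⟨l₁, l₂, rfl⟩ := List.append_of_mem (hlk hv)
    obtain ⟨a₁, a₂, h₁, h₂, ha⟩ := split hk
    obtain ⟨k'', rfl⟩ := hk'.eq_append_singleton
    refine ⟨l₁ ++ (k'' ++ v :: l₂), fun x hx => ?_, ?_⟩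
    · have := hlk hx
      simp only [List.mem_append] at this ⊢
      tauto
    · have := h₁.append (hk'.append h₂)
      rw [Multiset.sum_cons, add_left_comm, ha, add_left_comm]
      exact this

end Walk

/-- A long list over a set of at most `n` elements has a repetition at distance at most `n` such
that every element between the two occurrences also occurs before them. -/
theorem exists_redundant_repetition {V : Type} [Fintype V] {n : ℕ} (hn : Fintype.card V ≤ n)
    (l : List V) (hl : (n + 1) * (n + 1) < l.length) :
    ∃ l₁ v l₂ l₃, l = l₁ ++ v :: (l₂ ++ v :: l₃) ∧ l₂.length < n ∧ ∀ u ∈ l₂, u ∈ l₁ := by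
  classical
  -- Among `n + 1` consecutive blocks of length `n + 1`, one contains no first occurrence.
  obtain ⟨c, hc, hcV⟩ : ∃ c ∈ Finset.range (n + 1),
      c ∉ Finset.univ.image fun v : V => l.idxOf v / (n + 1) := by
    refine Finset.exists_mem_notMem_of_card_lt_card ?_
    refine Finset.card_image_le.trans_lt ?_
    rw [Finset.card_range, Finset.card_univ]
    omega
  rw [Finset.mem_range] at hc
  have hlen : ∀ i : Fin (n + 1), c * (n + 1) + i < l.length := fun i => by
    have := i.2
    nlinarith
  obtain ⟨i, j, hij, hv⟩ := Fintype.exists_ne_map_eq_of_card_lt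
    (fun i : Fin (n + 1) => l[c * (n + 1) + i]'(hlen i)) (by simpa using by omega)
  wlog hlt : i < j generalizing i j
  · exact this j i hij.symm hv.symm (lt_of_le_of_ne (not_lt.1 hlt) hij.symm)
  have hlt' : (i : ℕ) < j := hlt
  set p := c * (n + 1) + (i : ℕ) with hp
  set q := c * (n + 1) + (j : ℕ) with hq
  have hpl : p < l.length := hlen i
  have hql : q < l.length := hlen j
  have hj := j.2
  have hdrop : l.drop (p + 1) =
      (l.drop (p + 1)).take (q - p - 1) ++ l[p] :: l.drop (q + 1) := by
    conv_lhs => rw [← List.take_append_drop (q - p - 1) (l.drop (p + 1))]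
    rw [List.drop_drop, show p + 1 + (q - p - 1) = q by omega, List.drop_eq_getElem_cons hql]
    rw [hv]
  refine ⟨l.take p, l[p], (l.drop (p + 1)).take (q - p - 1), l.drop (q + 1), ?_, ?_, ?_⟩
  · rw [← hdrop, ← List.drop_eq_getElem_cons hpl, List.take_append_drop]
  · rw [List.length_take, List.length_drop]
    omega
  · intro u hu
    obtain ⟨r, hr, rfl⟩ := List.getElem_of_mem hu
    rw [List.length_take, List.length_drop] at hr
    simp only [List.getElem_take, List.getElem_drop]
    have hrl : p + 1 + r < l.length := by omega
    have hidx : l.idxOf l[p + 1 + r] ≤ p + 1 + r := by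
      by_contra! hlt
      simpa using List.not_of_lt_findIdx hlt
    have hne : l.idxOf l[p + 1 + r] / (n + 1) ≠ c := fun h =>
      hcV (Finset.mem_image.2 ⟨_, Finset.mem_univ _, h⟩)
    have hle : l.idxOf l[p + 1 + r] / (n + 1) ≤ c := by
      refine Nat.lt_succ_iff.1 ((Nat.div_lt_iff_lt_mul (Nat.succ_pos n)).2 (hidx.trans_lt ?_))
      rw [Nat.succ_mul, Nat.succ_eq_add_one]
      omega
    have hlt : l.idxOf l[p + 1 + r] < c * (n + 1) :=
      (Nat.div_lt_iff_lt_mul (Nat.succ_pos n)).1 (lt_of_le_of_ne hle hne)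
    have hp' : l.idxOf l[p + 1 + r] < p := by omega
    rw [List.mem_take_iff_getElem]
    refine ⟨l.idxOf l[p + 1 + r], by omega, ?_⟩
    exact List.getElem_idxOf (by omega)

/-- A walk consists of a walk of bounded length and of short cycles attached to it. Cutting out only
redundant repetitions keeps the set of visited vertices, so that all cycles remain attached. -/
theorem Walk.decompose {V A : Type} [AddCommMonoid A] [Fintype V] {E : V → A → V → Prop} {n : ℕ}
    (hn : Fintype.card V ≤ n) {l : List V} {u t : V} {a : A} (h : Walk E u l a t) :
    ∃ (k : List V) (b : A) (s : Multiset A), k.length ≤ (n + 1) * (n + 1) ∧ Walk E u k b t ∧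
      a = b + s.sum ∧
      ∀ c ∈ s, ∃ v ∈ k, ∃ l', 2 ≤ l'.length ∧ l'.length ≤ n + 1 ∧ Walk E v l' c v := by
  suffices H : ∃ (k : List V) (b : A) (s : Multiset A), k.length ≤ (n + 1) * (n + 1) ∧
      Walk E u k b t ∧ a = b + s.sum ∧ l ⊆ k ∧
      ∀ c ∈ s, ∃ v ∈ k, ∃ l', 2 ≤ l'.length ∧ l'.length ≤ n + 1 ∧ Walk E v l' c v by
    obtain ⟨k, b, s, h₁, h₂, h₃, _, h₄⟩ := H
    exact ⟨k, b, s, h₁, h₂, h₃, h₄⟩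
  induction hlen : l.length using Nat.strong_induction_on generalizing l a with
  | _ m ih =>
  subst hlen
  by_cases hl : l.length ≤ (n + 1) * (n + 1)
  · exact ⟨l, a, 0, hl, h, by simp, List.Subset.refl l, by simp⟩
  obtain ⟨l₁, v, l₂, l₃, rfl, hl₂, hsub⟩ := exists_redundant_repetition hn l (not_le.1 hl)
  obtain ⟨a₁, a₂, h₁, h₂, rfl⟩ := h.split
  obtain ⟨a₃, a₄, h₃, h₄, rfl⟩ := Walk.split (l₁ := v :: l₂) h₂
  obtain ⟨k, b, s, hk, hb, hbs, hlk, hs⟩ := ih _ (by simp) (h₁.append h₄) rfl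
  refine ⟨k, b, a₃ ::ₘ s, hk, hb, ?_, fun x hx => ?_, ?_⟩
  · rw [Multiset.sum_cons, add_left_comm b, ← hbs, add_left_comm]
  · refine hlk ?_
    have := hsub x
    simp only [List.mem_append, List.mem_cons] at hx ⊢
    tauto
  · intro c hc
    rcases Multiset.mem_cons.1 hc with rfl | hc
    · exact ⟨v, hlk (by simp), _, by simp, by simp; omega, h₃⟩
    · exact hs c hc

/-- The cost of a walk that is needed below: its number of edges, the number of letters that it
reads, and its weight vector. -/
abbrev WalkCost (ι : Type) : Type := ℕ × ℕ × (ι → ℤ)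

/-- Walks of weight zero with more edges than this can be pumped; `n` bounds the number of vertices
and the entries of the edge weights, and `d` is the dimension of the weights. -/
def walkBound (d n : ℕ) : ℕ := (n + 1) * (n + 1) + n * zeroSumBound d ((n + 1) * (n + 1) * n)

section

variable {V ι : Type} {E : V → WalkCost ι → V → Prop} {n : ℕ}

theorem Walk.fst_cost (hE : ∀ u a v, E u a v → a.1 = 1) {l : List V} {u t : V} {a : WalkCost ι}
    (h : Walk E u l a t) : a.1 + 1 = l.length := by
  induction h with
  | nil => rfl
  | cons he _ ih =>
    have := hE _ _ _ he
    simp only [Prod.fst_add, List.length_cons]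
    omega

theorem Walk.abs_weight_le (hE : ∀ u a v, E u a v → a.1 = 1)
    (hW : ∀ u a v, E u a v → ∀ i, |a.2.2 i| ≤ n) {l : List V} {u t : V} {a : WalkCost ι}
    (h : Walk E u l a t) (i : ι) : |a.2.2 i| ≤ a.1 * n := by
  induction h with
  | nil => simp
  | @cons _ _ _ _ a b he _ ih =>
    have h1 := hE _ _ _ he
    have h2 := hW _ _ _ he i
    have h3 := abs_add_le (a.2.2 i) (b.2.2 i)
    simp only [Prod.fst_add, Prod.snd_add, Pi.add_apply, h1]
    push_cast
    linarith

theorem snd_snd_multiset_sum (s : Multiset (WalkCost ι)) (i : ι) :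
    s.sum.2.2 i = (s.map fun c => c.2.2 i).sum := by
  induction s using Multiset.induction_on with
  | empty => rfl
  | cons a s ih => simp [ih]

theorem fst_multiset_sum (s : Multiset (WalkCost ι)) : s.sum.1 = (s.map fun c => c.1).sum := by
  induction s using Multiset.induction_on with
  | empty => rfl
  | cons a s ih => simp [ih]

/-- The pumping lemma for walks of weight zero. A long walk is a short skeleton with many short
cycles attached; as the total weight is zero, some of the cycles have total weight zero, and these
can be dropped or repeated. -/
theorem Walk.pump [Fintype V] [Fintype ι] (hn : Fintype.card V ≤ n)
    (hE : ∀ u a v, E u a v → a.1 = 1) (hW : ∀ u a v, E u a v → ∀ i, |a.2.2 i| ≤ n)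
    {l : List V} {u t : V} {a : WalkCost ι} (h : Walk E u l a t) (h0 : a.2.2 = 0)
    (hlong : walkBound (Fintype.card ι) n < a.1) :
    ∃ b c : WalkCost ι, a = b + c ∧ b.2.2 = 0 ∧ c.2.2 = 0 ∧ 1 ≤ c.1 ∧
      ∀ m : ℕ, ∃ k, Walk E u k (b + m • c) t := by
  obtain ⟨k, b, s, hk, hb, rfl, hs⟩ := h.decompose hn
  set N := (n + 1) * (n + 1) with hN
  have hnN : n ≤ N := by nlinarith
  have hb1 := hb.fst_cost hE
  have hs1 : ∀ c ∈ s, 1 ≤ c.1 ∧ c.1 ≤ n := fun c hc => by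
    obtain ⟨v, _, l', h2, h3, h4⟩ := hs c hc
    have := h4.fst_cost hE
    omega
  have hsum1 : s.sum.1 ≤ s.card * n := by
    rw [fst_multiset_sum, ← Multiset.card_map (fun c : WalkCost ι => c.1), ← smul_eq_mul]
    refine Multiset.sum_le_card_nsmul _ _ fun x hx => ?_
    obtain ⟨c, hc, rfl⟩ := Multiset.mem_map.1 hx
    exact (hs1 c hc).2
  obtain ⟨T, hTs, hT0, hT⟩ := exists_zero_sum (Finset.univ : Finset ι)
    (fun c : WalkCost ι => c.2.2) (N * n) s
    (fun c hc i _ => by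
      obtain ⟨v, _, l', h2, h3, h4⟩ := hs c hc
      have h5 := h4.abs_weight_le hE hW i
      have h6 : ((c.1 * n : ℕ) : ℤ) ≤ (N * n : ℕ) := by
        exact_mod_cast Nat.mul_le_mul_right n ((hs1 c hc).2.trans hnN)
      push_cast at h6 ⊢
      exact h5.trans h6)
    (fun i _ => by
      have h5 := hb.abs_weight_le hE hW i
      have h6 : ((b.1 * n : ℕ) : ℤ) ≤ (N * n : ℕ) := by
        exact_mod_cast Nat.mul_le_mul_right n (by omega)
      have h7 := congrFun h0 i
      simp only [Prod.snd_add, Pi.add_apply, Pi.zero_apply] at h7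
      rw [← snd_snd_multiset_sum, show s.sum.2.2 i = - b.2.2 i by linarith, abs_neg]
      push_cast at h6 ⊢
      exact h5.trans h6)
    (by
      by_contra! hle
      rw [Finset.card_univ] at hle
      have h5 := Nat.mul_le_mul_left n hle
      rw [walkBound, ← hN, Prod.fst_add] at hlong
      rw [mul_comm] at hsum1
      omega)
  obtain ⟨U, rfl⟩ := Multiset.le_iff_exists_add.1 hTs
  have hTz : T.sum.2.2 = 0 := funext fun i => by
    rw [snd_snd_multiset_sum]
    exact hT i (Finset.mem_univ i)
  refine ⟨b + U.sum, T.sum, ?_, ?_, hTz, ?_, fun m => ?_⟩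
  · rw [Multiset.sum_add, add_assoc, add_comm U.sum]
  · rw [← h0]
    simp [hTz]
  · obtain ⟨c, hc⟩ := Multiset.exists_mem_of_ne_zero hT0
    obtain ⟨T', rfl⟩ := Multiset.exists_cons_of_mem hc
    have := (hs1 c (by simp)).1
    rw [Multiset.sum_cons, Prod.fst_add]
    omega
  · obtain ⟨k', _, hk'⟩ := hb.insert_cycles (U + m • T) fun c hc => by
      have hc' : c ∈ T + U := by
        rcases Multiset.mem_add.1 hc with hc | hc
        · exact Multiset.mem_add.2 (Or.inr hc)
        · exact Multiset.mem_add.2 (Or.inl (Multiset.mem_of_mem_nsmul hc))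
      obtain ⟨v, hv, l', _, _, h4⟩ := hs c hc'
      exact ⟨v, hv, l', h4⟩
    refine ⟨k', ?_⟩
    rw [Multiset.sum_add, Multiset.sum_nsmul, ← add_assoc] at hk'
    exact hk'

end

end WatsonCrick

/-! ### Weighted automata -/

namespace WatsonCrick

/-- A nondeterministic automaton over the alphabet `σ` with states `V`, moves without input
(`none`), and a weight in `W` on every edge. -/
structure WeightedNFA (σ W V : Type) where
  edge : V → Option σ → W → V → Prop
  start : V → Prop
  final : V → Prop

namespace WeightedNFA

section

variable {σ W W₁ W₂ V V₁ V₂ : Type} [AddCommMonoid W] [AddCommMonoid W₁] [AddCommMonoid W₂]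

/-- `N.Path u l a t`: some path from `u` to `t` reads the word `l` and has total weight `a`. -/
inductive Path (N : WeightedNFA σ W V) : V → List σ → W → V → Prop
  | nil (v : V) : Path N v [] 0 v
  | cons {u v t : V} {o : Option σ} {l : List σ} {a b : W} :
      N.edge u o a v → Path N v l b t → Path N u (o.toList ++ l) (a + b) t

/-- The word `l` is accepted with total weight `a`. -/
def Accepts (N : WeightedNFA σ W V) (l : List σ) (a : W) : Prop :=
  ∃ u t, N.start u ∧ N.final t ∧ N.Path u l a t

theorem Path.snoc {N : WeightedNFA σ W V} {u v t : V} {o : Option σ} {l : List σ} {a b : W}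
    (h : N.Path u l a v) (he : N.edge v o b t) : N.Path u (l ++ o.toList) (a + b) t := by
  induction h with
  | nil v =>
    have := Path.cons he (.nil t)
    simpa using this
  | cons hf _ ih =>
    rw [List.append_assoc, add_assoc]
    exact .cons hf (ih he)

/-- The automaton with all edges reversed. -/
def reverse (N : WeightedNFA σ W V) : WeightedNFA σ W V where
  edge u o a v := N.edge v o a u
  start := N.final
  final := N.start

theorem Path.reverse {N : WeightedNFA σ W V} {u t : V} {l : List σ} {a : W}
    (h : N.Path u l a t) : N.reverse.Path t l.reverse a u := by
  induction h with
  | nil v => exact .nil v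
  | @cons _ _ _ o _ _ _ he _ ih =>
    have h := ih.snoc (N := N.reverse) he
    have ho : o.toList.reverse = o.toList := by cases o <;> rfl
    rwa [List.reverse_append, ho, add_comm]

theorem accepts_reverse {N : WeightedNFA σ W V} {l : List σ} {a : W} :
    N.reverse.Accepts l a ↔ N.Accepts l.reverse a := by
  constructor
  · rintro ⟨u, t, hu, ht, h⟩
    exact ⟨t, u, ht, hu, h.reverse⟩
  · rintro ⟨u, t, hu, ht, h⟩
    refine ⟨t, u, ht, hu, ?_⟩
    simpa using h.reverse

/-- Edges of the synchronous product. -/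
inductive ProdEdge (N₁ : WeightedNFA σ W₁ V₁) (N₂ : WeightedNFA σ W₂ V₂) (f : W₁ × W₂ →+ W) :
    V₁ × V₂ → Option σ → W → V₁ × V₂ → Prop
  | letter {u₁ v₁ : V₁} {u₂ v₂ : V₂} {a : W₁} {b : W₂} (x : σ) :
      N₁.edge u₁ (some x) a v₁ → N₂.edge u₂ (some x) b v₂ →
        ProdEdge N₁ N₂ f (u₁, u₂) (some x) (f (a, b)) (v₁, v₂)
  | left {u₁ v₁ : V₁} {a : W₁} (u₂ : V₂) :
      N₁.edge u₁ none a v₁ → ProdEdge N₁ N₂ f (u₁, u₂) none (f (a, 0)) (v₁, u₂)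
  | right {u₂ v₂ : V₂} {b : W₂} (u₁ : V₁) :
      N₂.edge u₂ none b v₂ → ProdEdge N₁ N₂ f (u₁, u₂) none (f (0, b)) (u₁, v₂)

/-- The product automaton accepts the words that both automata accept; the homomorphism `f`
combines the two weights. -/
def prod (N₁ : WeightedNFA σ W₁ V₁) (N₂ : WeightedNFA σ W₂ V₂) (f : W₁ × W₂ →+ W) :
    WeightedNFA σ W (V₁ × V₂) where
  edge := ProdEdge N₁ N₂ f
  start u := N₁.start u.1 ∧ N₂.start u.2
  final u := N₁.final u.1 ∧ N₂.final u.2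

variable {N₁ : WeightedNFA σ W₁ V₁} {N₂ : WeightedNFA σ W₂ V₂} {f : W₁ × W₂ →+ W}

theorem Path.of_prod {u t : V₁ × V₂} {l : List σ} {c : W} (h : (N₁.prod N₂ f).Path u l c t) :
    ∃ a b, N₁.Path u.1 l a t.1 ∧ N₂.Path u.2 l b t.2 ∧ c = f (a, b) := by
  induction h with
  | nil v => exact ⟨0, 0, .nil _, .nil _, (map_zero f).symm⟩
  | cons he _ ih =>
    obtain ⟨a, b, ha, hb, rfl⟩ := ih
    cases he with
    | letter x h₁ h₂ => exact ⟨_, _, .cons h₁ ha, .cons h₂ hb, by simp [← map_add]⟩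
    | left u₂ h₁ => exact ⟨_, b, .cons h₁ ha, hb, by simp [← map_add]⟩
    | right u₁ h₂ => exact ⟨a, _, ha, .cons h₂ hb, by simp [← map_add]⟩

theorem Path.prod {u₁ t₁ : V₁} {u₂ t₂ : V₂} {l : List σ} {a : W₁} {b : W₂}
    (h₁ : N₁.Path u₁ l a t₁) (h₂ : N₂.Path u₂ l b t₂) :
    (N₁.prod N₂ f).Path (u₁, u₂) l (f (a, b)) (t₁, t₂) := by
  induction h₁ generalizing u₂ b with
  | nil v =>
    generalize hl : ([] : List σ) = l at h₂
    induction h₂ with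
    | nil w =>
      rw [show f (0, 0) = 0 from map_zero f]
      exact .nil _
    | @cons _ _ _ o l _ _ he _ ih =>
      cases o with
      | some x => simp at hl
      | none =>
        have := Path.cons (N := N₁.prod N₂ f) (ProdEdge.right v he) (ih hl)
        simpa [← map_add] using this
  | @cons _ _ _ o l a b he hp ih =>
    cases o with
    | none =>
      have := Path.cons (N := N₁.prod N₂ f) (ProdEdge.left u₂ he) (ih h₂)
      simpa [← map_add] using this
    | some x =>
      generalize hl : (some x).toList ++ l = l' at h₂
      induction h₂ with
      | nil w => simp at hl
      | @cons _ _ _ o _ _ _ he' hp' ih' =>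
        cases o with
        | none =>
          have := Path.cons (N := N₁.prod N₂ f) (ProdEdge.right _ he') (ih' ih hl)
          simpa [← map_add] using this
        | some y =>
          simp only [Option.toList_some, List.cons_append, List.nil_append,
            List.cons.injEq] at hl
          obtain ⟨rfl, rfl⟩ := hl
          have := Path.cons (N := N₁.prod N₂ f) (ProdEdge.letter x he he') (ih hp')
          simpa [← map_add] using this

theorem accepts_prod {l : List σ} {c : W} :
    (N₁.prod N₂ f).Accepts l c ↔ ∃ a b, N₁.Accepts l a ∧ N₂.Accepts l b ∧ c = f (a, b) := by
  constructor
  · rintro ⟨u, t, hu, ht, h⟩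
    obtain ⟨a, b, ha, hb, rfl⟩ := h.of_prod
    exact ⟨a, b, ⟨_, _, hu.1, ht.1, ha⟩, ⟨_, _, hu.2, ht.2, hb⟩, rfl⟩
  · rintro ⟨a, b, ⟨u₁, t₁, hu₁, ht₁, h₁⟩, ⟨u₂, t₂, hu₂, ht₂, h₂⟩, rfl⟩
    exact ⟨(u₁, u₂), (t₁, t₂), ⟨hu₁, hu₂⟩, ⟨ht₁, ht₂⟩, h₁.prod h₂⟩

/-- The unweighted automaton for the words with at least `m` letters that satisfy `p`. -/
def countFilter (p : σ → Bool) (m : ℕ) : WeightedNFA σ Unit (Fin (m + 1)) where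
  edge i o _ j := ∃ x, o = some x ∧ (j = i ∨ (p x = true ∧ (j : ℕ) = i + 1))
  start i := (i : ℕ) = 0
  final i := (i : ℕ) = m

theorem accepts_countFilter {p : σ → Bool} {m : ℕ} {l : List σ} {a : Unit} :
    (countFilter p m).Accepts l a ↔ m ≤ l.countP p := by
  constructor
  · rintro ⟨u, t, hu, ht, h⟩
    have H : (t : ℕ) ≤ u + l.countP p := by
      clear hu ht
      induction h with
      | nil => simp
      | cons he _ ih =>
        obtain ⟨x, rfl, h⟩ := he
        rw [Option.toList_some, List.singleton_append, List.countP_cons]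
        rcases h with rfl | ⟨hp, h⟩
        · omega
        · rw [if_pos hp]
          omega
    simp only [countFilter] at hu ht
    omega
  · intro h
    suffices H : ∀ u : Fin (m + 1), m ≤ u + l.countP p →
        (countFilter p m).Path u l () (Fin.last m) from
      ⟨0, Fin.last m, rfl, rfl, H 0 (by simpa using h)⟩
    clear h
    induction l with
    | nil =>
      intro u hu
      have : u = Fin.last m := Fin.ext (by simp at hu ⊢; omega)
      rw [this]
      exact .nil _
    | cons x l ih =>
      intro u hu
      rw [List.countP_cons] at hu
      by_cases hp : p x = true ∧ (u : ℕ) < m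
      · rw [if_pos hp.1] at hu
        exact .cons (o := some x) (a := ()) (b := ())
          ⟨x, rfl, Or.inr ⟨hp.1, rfl⟩⟩ (ih ⟨u + 1, by omega⟩ (by simp; omega))
      · refine .cons (o := some x) (a := ()) (b := ()) ⟨x, rfl, Or.inl rfl⟩ (ih u ?_)
        rw [not_and_or] at hp
        rcases hp with hp | hp
        · rw [if_neg hp] at hu
          omega
        · omega

end

section

variable {σ V ι : Type} {N : WeightedNFA σ (ι → ℤ) V} {n : ℕ}

/-- The edges of the automaton with the letters forgotten; only their number is kept. -/
def forget (N : WeightedNFA σ (ι → ℤ) V) : V → WalkCost ι → V → Prop :=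
  fun u a v => ∃ o, N.edge u o a.2.2 v ∧ a.1 = 1 ∧ a.2.1 = o.toList.length

theorem Path.exists_walk {u t : V} {l : List σ} {a : ι → ℤ} (h : N.Path u l a t) :
    ∃ k m, l.length ≤ m ∧ Walk N.forget u k (m, l.length, a) t := by
  induction h with
  | nil v => exact ⟨_, 0, le_rfl, .nil v⟩
  | @cons _ _ _ o l a b he _ ih =>
    obtain ⟨k, m, hm, hk⟩ := ih
    have h1 : o.toList.length ≤ 1 := by cases o <;> simp
    have hw := Walk.cons (a := (1, o.toList.length, a)) ⟨o, he, rfl, rfl⟩ hk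
    rw [List.length_append]
    exact ⟨_, 1 + m, by omega, hw⟩

theorem exists_path_of_walk {u t : V} {k : List V} {a : WalkCost ι} (h : Walk N.forget u k a t) :
    ∃ l, N.Path u l a.2.2 t ∧ l.length = a.2.1 ∧ a.2.1 ≤ a.1 := by
  induction h with
  | nil v => exact ⟨[], .nil v, rfl, le_rfl⟩
  | cons he _ ih =>
    obtain ⟨l, hl, hlen, hle⟩ := ih
    obtain ⟨o, he, h1, h2⟩ := he
    have h3 : o.toList.length ≤ 1 := by cases o <;> simp
    refine ⟨_, .cons he hl, ?_, ?_⟩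
    · rw [List.length_append, hlen, Prod.snd_add, Prod.fst_add, h2]
    · simp only [Prod.snd_add, Prod.fst_add]
      omega

/-- The costs of accepting walks of weight zero. -/
def acceptingCosts (N : WeightedNFA σ (ι → ℤ) V) : Set (WalkCost ι) :=
  {a | a.2.2 = 0 ∧ ∃ u t k, N.start u ∧ N.final t ∧ Walk N.forget u k a t}

theorem Accepts.exists_mem_acceptingCosts {l : List σ} (h : N.Accepts l 0) :
    ∃ a ∈ N.acceptingCosts, a.2.1 = l.length ∧ l.length ≤ a.1 := by
  obtain ⟨u, t, hu, ht, h⟩ := h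
  obtain ⟨k, m, hm, hk⟩ := h.exists_walk
  exact ⟨_, ⟨rfl, u, t, k, hu, ht, hk⟩, rfl, hm⟩

theorem exists_accepts_of_mem {a : WalkCost ι} (h : a ∈ N.acceptingCosts) :
    ∃ l, N.Accepts l 0 ∧ l.length = a.2.1 ∧ a.2.1 ≤ a.1 := by
  obtain ⟨h0, u, t, k, hu, ht, hk⟩ := h
  obtain ⟨l, hl, h1⟩ := exists_path_of_walk hk
  rw [h0] at hl
  exact ⟨l, ⟨u, t, hu, ht, hl⟩, h1⟩

/-- States and weights of the automaton are bounded by `n`. -/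
structure BoundedBy [Fintype V] (N : WeightedNFA σ (ι → ℤ) V) (n : ℕ) : Prop where
  card_le : Fintype.card V ≤ n
  weight_le : ∀ u o a v, N.edge u o a v → ∀ i, |a i| ≤ n

variable [Fintype V] [Fintype ι]

theorem BoundedBy.pump (hN : N.BoundedBy n) {a : WalkCost ι} (ha : a ∈ N.acceptingCosts)
    (hlong : walkBound (Fintype.card ι) n < a.1) :
    ∃ b c : WalkCost ι, a = b + c ∧ 1 ≤ c.1 ∧ ∀ m : ℕ, b + m • c ∈ N.acceptingCosts := by
  obtain ⟨h0, u, t, k, hu, ht, hk⟩ := ha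
  obtain ⟨b, c, hbc, hb, hc, hc1, H⟩ := hk.pump hN.card_le
    (by rintro u a v ⟨o, -, h, -⟩; exact h)
    (by rintro u a v ⟨o, h, -, -⟩; exact hN.weight_le _ _ _ _ h) h0 hlong
  refine ⟨b, c, hbc, hc1, fun m => ⟨?_, u, t, ?_⟩⟩
  · simp [hb, hc]
  · obtain ⟨k', hk'⟩ := H m
    exact ⟨k', hu, ht, hk'⟩

theorem BoundedBy.exists_short (hN : N.BoundedBy n) {l : List σ} (h : N.Accepts l 0) :
    ∃ l', N.Accepts l' 0 ∧ l'.length ≤ walkBound (Fintype.card ι) n := by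
  obtain ⟨a₀, ha₀, -⟩ := h.exists_mem_acceptingCosts
  obtain ⟨a, ha, hmin⟩ := (measure fun a : WalkCost ι => a.1).wf.has_min N.acceptingCosts
    ⟨a₀, ha₀⟩
  obtain ⟨l', hl', hlen, hle⟩ := exists_accepts_of_mem ha
  refine ⟨l', hl', ?_⟩
  by_contra! hlong
  obtain ⟨b, c, rfl, hc, H⟩ := hN.pump ha (by omega)
  refine hmin _ (H 0) (show (b + 0 • c).1 < (b + c).1 from ?_)
  simp only [zero_smul, add_zero, Prod.fst_add]
  omega

/-- If the word lengths were bounded, a walk with fewest edges among those that read a longest word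
could be pumped down or up. -/
theorem BoundedBy.exists_arbitrarily_long (hN : N.BoundedBy n) {l : List σ} (h : N.Accepts l 0)
    (hl : walkBound (Fintype.card ι) n < l.length) (m : ℕ) :
    ∃ l', N.Accepts l' 0 ∧ m ≤ l'.length := by
  by_contra! hcon
  have hletters : ∀ a ∈ N.acceptingCosts, a.2.1 < m := fun a ha => by
    obtain ⟨l', hl', hlen, -⟩ := exists_accepts_of_mem ha
    exact hlen ▸ hcon l' hl'
  obtain ⟨a₀, ha₀, hlen₀, -⟩ := h.exists_mem_acceptingCosts
  obtain ⟨a₁, ha₁, hmax⟩ := (measure fun a : WalkCost ι => m - a.2.1).wf.has_min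
    N.acceptingCosts ⟨a₀, ha₀⟩
  obtain ⟨a, ⟨ha, haeq⟩, hmin⟩ := (measure fun a : WalkCost ι => a.1).wf.has_min
    {a | a ∈ N.acceptingCosts ∧ a.2.1 = a₁.2.1} ⟨a₁, ha₁, rfl⟩
  have hlong : walkBound (Fintype.card ι) n < a.1 := by
    obtain ⟨l', hl', hlen, hle⟩ := exists_accepts_of_mem ha
    have h1 : ¬ m - a₀.2.1 < m - a₁.2.1 := hmax a₀ ha₀
    have h2 := hletters a₀ ha₀
    have h3 := hletters a₁ ha₁
    omega
  -- Dropping `c` gives a shorter walk if `c` reads nothing, and otherwise repeating `c` reads more.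
  obtain ⟨b, c, rfl, hc, H⟩ := hN.pump ha hlong
  rcases Nat.eq_zero_or_pos c.2.1 with h0 | h0
  · refine hmin _ ⟨H 0, by rw [← haeq]; simp [h0]⟩ (show (b + 0 • c).1 < (b + c).1 from ?_)
    simp only [zero_smul, add_zero, Prod.fst_add]
    omega
  · have h1 : ¬ m - (b + 2 • c).2.1 < m - a₁.2.1 := hmax _ (H 2)
    have h2 := hletters _ (H 2)
    have h3 : (b + 2 • c).2.1 = b.2.1 + 2 * c.2.1 := by simp
    rw [Prod.snd_add, Prod.fst_add] at haeq
    omega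

end

end WeightedNFA

end WatsonCrick

/-! ### One-way machines -/

namespace WatsonCrick

/-- A one-way machine with states `S` starts in state `s` on the first square of the tape `l` and
stops, on some square, in a situation that satisfies `F`, after steps of total weight `a`.
In a step `T s x a s' d` it replaces the state `s` by `s'` on reading `x`, and moves by `d`. -/
inductive Reads {σ S W : Type} [AddCommMonoid W] (T : S → σ → W → S → Move → Prop)
    (F : S → σ → Prop) : S → List σ → W → Prop
  | halt {s : S} {x : σ} {l : List σ} : F s x → Reads T F s (x :: l) 0
  | step {s s' : S} {x : σ} {l : List σ} {a b : W} {d : Move} :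
      T s x a s' d → Reads T F s' ((x :: l).drop d.dist) b → Reads T F s (x :: l) (a + b)

theorem Reads.exists_cons {σ S W : Type} [AddCommMonoid W] {T : S → σ → W → S → Move → Prop}
    {F : S → σ → Prop} {s : S} {l : List σ} {a : W} (h : Reads T F s l a) :
    ∃ x l', l = x :: l' := by
  cases h <;> exact ⟨_, _, rfl⟩

section

variable {σ S W : Type} [AddCommMonoid W] {T : S → σ → W → S → Move → Prop} {F : S → σ → Prop}

/-- Edges of the automaton that simulates a one-way machine. The state `some (s, x)` means that the
machine is in state `s` and scans the symbol `x`, which the automaton has guessed but not yet read;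
in the state `none` the machine has stopped and the automaton reads the remaining symbols. -/
inductive ScanEdge (T : S → σ → W → S → Move → Prop) (F : S → σ → Prop) :
    Option (S × σ) → Option σ → W → Option (S × σ) → Prop
  | stay {s s' : S} {x : σ} {a : W} :
      T s x a s' .stay → ScanEdge T F (some (s, x)) none a (some (s', x))
  | advance {s s' : S} {x : σ} {a : W} (y : σ) :
      T s x a s' .advance → ScanEdge T F (some (s, x)) (some x) a (some (s', y))
  | halt {s : S} {x : σ} : F s x → ScanEdge T F (some (s, x)) (some x) 0 none
  | rest (y : σ) : ScanEdge T F none (some y) 0 none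

/-- The automaton that simulates a one-way machine. -/
def scanner (T : S → σ → W → S → Move → Prop) (F : S → σ → Prop) (s : S) :
    WeightedNFA σ W (Option (S × σ)) where
  edge := ScanEdge T F
  start v := ∃ x, v = some (s, x)
  final v := v = none

theorem scanner_rest (s : S) (l : List σ) : (scanner T F s).Path none l 0 none := by
  induction l with
  | nil => exact .nil _
  | cons y l ih =>
    have := WeightedNFA.Path.cons (N := scanner T F s) (ScanEdge.rest y) ih
    simpa using this

theorem accepts_scanner {s : S} {l : List σ} {a : W} :
    (scanner T F s).Accepts l a ↔ Reads T F s l a := by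
  constructor
  · rintro ⟨u, t, ⟨x, rfl⟩, ht, h⟩
    suffices H : ∀ u, (scanner T F s).Path u l a t → (u = none → a = 0) ∧
        ∀ s' x, u = some (s', x) → ∃ l', l = x :: l' ∧ Reads T F s' l a by
      obtain ⟨_, _, h⟩ := (H _ h).2 s x rfl
      exact h
    clear h
    intro u h
    induction h with
    | nil v =>
      refine ⟨fun _ => rfl, fun s' x hv => ?_⟩
      change v = none at ht
      rw [ht] at hv
      simp at hv
    | cons he _ ih =>
      obtain ⟨ih0, ih⟩ := ih ht
      cases he with
      | stay hT =>
        refine ⟨by simp, ?_⟩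
        rintro s' x hx
        simp only [Option.some.injEq, Prod.mk.injEq] at hx
        obtain ⟨rfl, rfl⟩ := hx
        obtain ⟨l', rfl, hr⟩ := ih _ _ rfl
        exact ⟨l', rfl, .step hT hr⟩
      | advance y hT =>
        refine ⟨by simp, ?_⟩
        rintro s' x hx
        simp only [Option.some.injEq, Prod.mk.injEq] at hx
        obtain ⟨rfl, rfl⟩ := hx
        obtain ⟨l', rfl, hr⟩ := ih _ _ rfl
        exact ⟨_, rfl, .step hT hr⟩
      | halt hF =>
        refine ⟨by simp, ?_⟩
        rintro s' x hx
        simp only [Option.some.injEq, Prod.mk.injEq] at hx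
        obtain ⟨rfl, rfl⟩ := hx
        rw [ih0 rfl, add_zero]
        exact ⟨_, rfl, .halt hF⟩
      | rest y => exact ⟨fun _ => by rw [ih0 rfl, add_zero], by simp⟩
  · intro h
    obtain ⟨x, l', rfl⟩ := h.exists_cons
    refine ⟨some (s, x), none, ⟨x, rfl⟩, rfl, ?_⟩
    suffices H : ∀ s' l, Reads T F s' l a → ∀ x l', l = x :: l' →
        (scanner T F s).Path (some (s', x)) l a none from H s _ h x l' rfl
    clear h
    intro s' l h
    induction h with
    | @halt _ _ k hF =>
      rintro x l' hl
      obtain ⟨rfl, rfl⟩ := List.cons.inj hl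
      have := WeightedNFA.Path.cons (N := scanner T F s) (ScanEdge.halt hF) (scanner_rest s k)
      simpa using this
    | @step _ _ _ _ _ _ d hT hr ih =>
      rintro x l' hl
      obtain ⟨rfl, rfl⟩ := List.cons.inj hl
      cases d with
      | stay => exact .cons (N := scanner T F s) (ScanEdge.stay hT) (ih _ _ rfl)
      | advance =>
        obtain ⟨y, l'', hl''⟩ := hr.exists_cons
        exact .cons (N := scanner T F s) (ScanEdge.advance y hT) (ih _ _ hl'')

end

/-! ### The two components as one-way machines -/

/-- Weights of the machine that simulates one component of a run with at most `K` messages. When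
`e` messages remain to be sent, coordinate `inl e` counts the steps without messages, and
coordinate `inr e` holds the number of the situation in which the next message is sent. -/
abbrev PhaseWeight (K : ℕ) : Type := Fin (K + 1) ⊕ Fin (K + 1) → ℕ

section

variable {Γ M Q R : Type} {K : ℕ}

/-- One component, with the other one guessed. A state consists of the state of the component and
the number of messages (of both components) still to be sent. In a step with a message the joint
situation `r : R` is guessed, of which `own r` is the part seen by the component, `recv r` the
message received, `cnt r` the number of messages sent, and `num r` a number that identifies it. -/
inductive PhaseStep (D : Dynamics Γ M Q) (own : R → Q × TapeSymbol Γ) (recv : R → Option M)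
    (cnt num : R → ℕ) :
    Q × Fin (K + 1) → TapeSymbol Γ → PhaseWeight K → Q × Fin (K + 1) → Move → Prop
  | solo {p p' : Q} {x : TapeSymbol Γ} {d : Move} (e : Fin (K + 1)) :
      D.broadcast p x = none → D.trans p x none = some (p', d) →
        PhaseStep D own recv cnt num (p, e) x (Pi.single (.inl e) 1) (p', e) d
  | event {p p' : Q} {x : TapeSymbol Γ} {d : Move} {e e' : Fin (K + 1)} (r : R) :
      own r = (p, x) → D.trans p x (recv r) = some (p', d) → 1 ≤ cnt r →
        (e : ℕ) = cnt r + e' →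
        PhaseStep D own recv cnt num (p, e) x (Pi.single (.inr e) (num r)) (p', e') d

/-- The machine stops when no message remains and the part `r` of the final situation is seen. -/
def PhaseStop (r : Q × TapeSymbol Γ) (s : Q × Fin (K + 1)) (x : TapeSymbol Γ) : Prop :=
  (s.2 : ℕ) = 0 ∧ r = (s.1, x)

/-- The coordinates of phases that are already over, because fewer than `e` messages remain to be
sent, vanish. -/
theorem Reads.phase_weight_eq_zero {D : Dynamics Γ M Q} {own : R → Q × TapeSymbol Γ}
    {recv : R → Option M} {cnt num : R → ℕ} {F : Q × Fin (K + 1) → TapeSymbol Γ → Prop}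
    {s : Q × Fin (K + 1)} {l : List (TapeSymbol Γ)} {a : PhaseWeight K}
    (h : Reads (PhaseStep D own recv cnt num) F s l a) (e : Fin (K + 1)) (he : s.2 < e) :
    a (.inl e) = 0 ∧ a (.inr e) = 0 := by
  induction h with
  | halt => exact ⟨rfl, rfl⟩
  | step hT _ ih =>
    cases hT with
    | solo e' =>
      have := ih he
      have hne : e ≠ e' := fun h => absurd he (by simp [h])
      simpa [hne] using this
    | @event _ _ _ _ e₁ e₂ r _ _ hc hr =>
      have h1 : e₂ < e := by
        simp only [Fin.lt_def] at he ⊢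
        omega
      have := ih h1
      have hne : e ≠ e₁ := fun h => absurd he (by simp [h])
      simpa [hne] using this

end

/-- The states of both components and the symbols that they scan. -/
abbrev Situation (Γ Q₁ Q₂ : Type) : Type := (Q₁ × TapeSymbol Γ) × (Q₂ × TapeSymbol Γ)

/-- In the configuration `c` on input `w`, the system is in the situation `r`. -/
def Scans {Γ Q₁ Q₂ : Type} (w : List Γ) (c : Config Q₁ Q₂) (r : Situation Γ Q₁ Q₂) : Prop :=
  c.state₁ = r.1.1 ∧ (tape w)[c.pos₁]? = some r.1.2 ∧
    c.state₂ = r.2.1 ∧ (tape w)[c.pos₂]? = some r.2.2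

namespace DPWK

variable {Γ M Q₁ Q₂ : Type} {K : ℕ}

/-- Number of messages sent in a situation. -/
def sent (A : DPWK Γ M Q₁ Q₂) (r : Situation Γ Q₁ Q₂) : ℕ :=
  messageCount (A.upper.broadcast r.1.1 r.1.2) + messageCount (A.lower.broadcast r.2.1 r.2.2)

/-- The one-way machine for the upper component. -/
def upperStep (A : DPWK Γ M Q₁ Q₂) (num : Situation Γ Q₁ Q₂ → ℕ) :
    Q₁ × Fin (K + 1) → TapeSymbol Γ → PhaseWeight K → Q₁ × Fin (K + 1) → Move → Prop :=
  PhaseStep A.upper.toDynamics Prod.fst (fun r => A.lower.broadcast r.2.1 r.2.2) A.sent num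

/-- The one-way machine for the lower component, which works on the reversed tape. -/
def lowerStep (A : DPWK Γ M Q₁ Q₂) (num : Situation Γ Q₁ Q₂ → ℕ) :
    Q₂ × Fin (K + 1) → TapeSymbol Γ → PhaseWeight K → Q₂ × Fin (K + 1) → Move → Prop :=
  PhaseStep A.lower.toDynamics Prod.snd (fun r => A.upper.broadcast r.1.1 r.1.2) A.sent num

theorem eq_none_of_messageCount {o : Option M} (h : messageCount o = 0) : o = none := by
  cases o with
  | none => rfl
  | some _ => simp [messageCount] at h

theorem getElem?_of_drop_eq_cons {α : Type} {l t : List α} {i : ℕ} {x : α}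
    (h : l.drop i = x :: t) : l[i]? = some x := by
  have := congrArg (fun l => l[0]?) h
  simpa using this

theorem getElem?_of_reverse_take_eq_cons {α : Type} {l t : List α} {j : ℕ} {x : α}
    (h : (l.take (j + 1)).reverse = x :: t) (hj : j < l.length) : l[j]? = some x := by
  have := congrArg (fun l => l[0]?) h
  simp only [List.getElem?_cons_zero] at this
  rw [List.getElem?_reverse (by rw [List.length_take]; omega), List.length_take,
    min_eq_left hj, List.getElem?_take] at this
  simpa using this

theorem drop_reverse_take {α : Type} (l : List α) {j d : ℕ} (hj : j < l.length) (hd : d ≤ j) :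
    ((l.take (j + 1)).reverse).drop d = (l.take (j - d + 1)).reverse := by
  rw [List.drop_reverse, List.length_take, List.take_take]
  congr 2
  omega

theorem le_of_drop_reverse_take {α : Type} {l t : List α} {j d : ℕ} {y : α}
    (h : ((l.take (j + 1)).reverse).drop d = y :: t) : d ≤ j := by
  have := congrArg List.length h
  simp only [List.length_drop, List.length_reverse, List.length_take, List.length_cons] at this
  omega

/-- One-way runs of the two components with equal weights combine to a joint run: the time
coordinates keep the components synchronous, the others make their guesses agree. -/
theorem exists_run_of_reads (A : DPWK Γ M Q₁ Q₂) {num : Situation Γ Q₁ Q₂ → ℕ}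
    (hnum : Function.Injective num) {w : List Γ} {r : Situation Γ Q₁ Q₂} {s : Q₁ × Fin (K + 1)}
    {l : List (TapeSymbol Γ)} {a : PhaseWeight K}
    (h₁ : Reads (A.upperStep num) (PhaseStop r.1) s l a) :
    ∀ (q : Q₂) (i j : ℕ), l = (tape w).drop i → j < (tape w).length →
      Reads (A.lowerStep num) (PhaseStop r.2) (q, s.2) ((tape w).take (j + 1)).reverse a →
      ∃ c, A.Run w ⟨s.1, i, q, j⟩ c s.2 ∧ Scans w c r := by
  induction h₁ with
  | @halt s x l hF =>
    intro q i j hl hj h₂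
    have hx := getElem?_of_drop_eq_cons hl.symm
    generalize hk : ((tape w).take (j + 1)).reverse = k at h₂
    generalize ha : (0 : PhaseWeight K) = a at h₂
    cases h₂ with
    | halt hG =>
      have hy := getElem?_of_reverse_take_eq_cons hk hj
      refine ⟨⟨s.1, i, q, j⟩, by rw [hF.1]; exact .refl _, ?_⟩
      simp [Scans, hF.2, hG.2, hx, hy]
    | step hT _ =>
      exfalso
      cases hT with
      | solo e =>
        have := congrFun ha (.inl s.2)
        simp at this
        omega
      | event r _ _ hc hr =>
        have := hF.1
        omega
  | @step s s' x l a b d hT hr ih =>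
    intro q i j hl hj h₂
    have hx := getElem?_of_drop_eq_cons hl.symm
    have hdrop : (x :: l).drop d.dist = (tape w).drop (i + d.dist) := by
      rw [hl, List.drop_drop]
    have hi' : i + d.dist < (tape w).length := by
      obtain ⟨x', l', hl'⟩ := hr.exists_cons
      rw [hdrop] at hl'
      by_contra! hge
      rw [List.drop_eq_nil_of_le hge] at hl'
      simp at hl'
    generalize hk : ((tape w).take (j + 1)).reverse = k at h₂
    generalize hc : a + b = c at h₂
    cases h₂ with
    | halt hG =>
      exfalso
      cases hT with
      | solo e =>
        have := congrFun hc (.inl e)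
        simp at this
      | event r _ _ hc hr =>
        have := hG.1
        simp only at this
        omega
    | @step _ t' y _ a' b' d' hT' hr' =>
      have hy := getElem?_of_reverse_take_eq_cons hk hj
      have hd' : d'.dist ≤ j := by
        obtain ⟨y', l', hl'⟩ := hr'.exists_cons
        rw [← hk] at hl'
        exact le_of_drop_reverse_take hl'
      rw [← hk, drop_reverse_take _ hj hd'] at hr'
      cases hT with
      | @solo p p' _ _ e hb ht =>
        cases hT' with
        | @solo q q' _ _ _ hb' ht' =>
          obtain rfl := add_left_cancel hc
          obtain ⟨c', hrun, hsc⟩ := ih q' (i + d.dist) (j - d'.dist) hdrop (by omega) hr'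
          refine ⟨c', ?_, hsc⟩
          have hstep : A.StepWith w ⟨p, i, q, j⟩ ⟨p', i + d.dist, q', j - d'.dist⟩ 0 :=
            ⟨x, y, d, d', hx, hy, by rw [hb']; exact ht, by rw [hb]; exact ht', rfl,
              by simp only; omega, hi', by simp only; omega, by rw [hb, hb']; rfl⟩
          simpa using Run.cons hstep hrun
        | @event q q' _ _ _ e' r _ _ hcnt hr =>
          exfalso
          have h0 := hr'.phase_weight_eq_zero e (by simp only [Fin.lt_def]; simp only at hr; omega)
          have := congrFun hc (.inl e)
          simp [h0.1] at this
      | @event p p' _ _ e e' r₁ hown ht hcnt he =>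
        have h0 := hr.phase_weight_eq_zero e (by simp only [Fin.lt_def]; omega)
        cases hT' with
        | @solo q q' _ _ _ hb' ht' =>
          exfalso
          have := congrFun hc (.inl e)
          simp [h0.1] at this
          omega
        | @event q q' _ _ _ e'' r₂ hown' ht' hcnt' he' =>
          have h0' := hr'.phase_weight_eq_zero e (by
            simp only [Fin.lt_def]
            simp only at he'
            omega)
          have hnr := congrFun hc (.inr e)
          simp only [Pi.add_apply, Pi.single_eq_same, h0.2, h0'.2, add_zero] at hnr
          obtain rfl := hnum hnr
          obtain rfl := add_left_cancel hc
          have hee : e' = e'' := Fin.ext (by simp only at he he'; omega)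
          subst hee
          obtain ⟨c', hrun, hsc⟩ := ih q' (i + d.dist) (j - d'.dist) hdrop (by omega) hr'
          refine ⟨c', ?_, hsc⟩
          obtain ⟨⟨p₀, x₀⟩, ⟨q₀, y₀⟩⟩ := r₁
          simp only [Prod.mk.injEq] at hown hown'
          obtain ⟨rfl, rfl⟩ := hown
          obtain ⟨rfl, rfl⟩ := hown'
          have hstep : A.StepWith w ⟨p₀, i, q₀, j⟩ ⟨p', i + d.dist, q', j - d'.dist⟩
              (A.sent ((p₀, x₀), (q₀, y₀))) :=
            ⟨x₀, y₀, d, d', hx, hy, ht, ht', rfl, by simp only; omega, hi', by simp only; omega,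
              rfl⟩
          simp only
          rw [he]
          exact Run.cons hstep hrun

/-- A joint run splits into one-way runs of the two components with equal weights. -/
theorem exists_reads_of_run (A : DPWK Γ M Q₁ Q₂) (num : Situation Γ Q₁ Q₂ → ℕ) {w : List Γ}
    {r : Situation Γ Q₁ Q₂} {c c' : Config Q₁ Q₂} {m : ℕ} (h : A.Run w c c' m)
    (hr : Scans w c' r) (e : Fin (K + 1)) (he : (e : ℕ) = m) :
    ∃ a : PhaseWeight K,
      Reads (A.upperStep num) (PhaseStop r.1) (c.state₁, e) ((tape w).drop c.pos₁) a ∧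
      Reads (A.lowerStep num) (PhaseStop r.2) (c.state₂, e)
        ((tape w).take (c.pos₂ + 1)).reverse a := by
  induction h generalizing e with
  | refl c =>
    obtain ⟨h1, h2, h3, h4⟩ := hr
    obtain ⟨hi, hx⟩ := List.getElem?_eq_some_iff.1 h2
    obtain ⟨hj, hy⟩ := List.getElem?_eq_some_iff.1 h4
    refine ⟨0, ?_, ?_⟩
    · rw [List.drop_eq_getElem_cons hi]
      exact .halt ⟨he, by rw [h1, hx]⟩
    · rw [List.take_add_one, h4, List.reverse_append]
      exact .halt ⟨he, by rw [h3]⟩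
  | @cons c c' c'' m n hs _ ih =>
    obtain ⟨x, y, d₁, d₂, hx, hy, ht₁, ht₂, hp₁, hp₂, hl₁, hl₂, hm⟩ := hs
    obtain ⟨a, ha₁, ha₂⟩ := ih hr ⟨n, by omega⟩ rfl
    obtain ⟨hi, hx'⟩ := List.getElem?_eq_some_iff.1 hx
    obtain ⟨hj, hy'⟩ := List.getElem?_eq_some_iff.1 hy
    have hdrop : (tape w).drop c.pos₁ = x :: (tape w).drop (c.pos₁ + 1) := by
      rw [List.drop_eq_getElem_cons hi, hx']
    have htake : ((tape w).take (c.pos₂ + 1)).reverse = y :: ((tape w).take c.pos₂).reverse := by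
      rw [List.take_add_one, hy, List.reverse_append]
      rfl
    rw [hp₁, ← List.drop_drop, hdrop] at ha₁
    rw [show c'.pos₂ = c.pos₂ - d₂.dist by omega, ← drop_reverse_take _ hj (by omega), htake]
      at ha₂
    rw [hdrop, htake]
    rcases Nat.eq_zero_or_pos m with rfl | hpos
    · have hb₁ := eq_none_of_messageCount (Nat.eq_zero_of_add_eq_zero_right hm.symm)
      have hb₂ := eq_none_of_messageCount (Nat.eq_zero_of_add_eq_zero_left hm.symm)
      rw [hb₁] at ht₂
      rw [hb₂] at ht₁
      have hn : (⟨n, by omega⟩ : Fin (K + 1)) = e := Fin.ext (by simp only; omega)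
      rw [hn] at ha₁ ha₂
      exact ⟨_, .step (.solo e hb₁ ht₁) ha₁, .step (.solo e hb₂ ht₂) ha₂⟩
    · have hm' : m = A.sent ((c.state₁, x), (c.state₂, y)) := hm
      exact ⟨_, .step (.event ((c.state₁, x), (c.state₂, y)) rfl ht₁ (by omega)
          (by simp only; omega)) ha₁,
        .step (.event ((c.state₁, x), (c.state₂, y)) rfl ht₂ (by omega) (by simp only; omega)) ha₂⟩

end DPWK

end WatsonCrick

/-! ### Runs of two-party systems -/

namespace WatsonCrick

theorem length_tape {Γ : Type} (w : List Γ) : (tape w).length = w.length + 2 := by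
  simp [tape]

theorem getElem?_tape_eq_leftEnd {Γ : Type} {w : List Γ} {i : ℕ} :
    (tape w)[i]? = some .leftEnd ↔ i = 0 := by
  cases i with
  | zero => simp [tape]
  | succ i =>
    simp only [tape, List.getElem?_cons_succ, Nat.add_eq_zero_iff, one_ne_zero, and_false,
      iff_false]
    intro h
    have := List.mem_of_getElem? h
    simp at this

theorem getElem?_tape_eq_rightEnd {Γ : Type} {w : List Γ} {i : ℕ} :
    (tape w)[i]? = some .rightEnd ↔ i = w.length + 1 := by
  cases i with
  | zero => simp [tape]
  | succ i =>
    simp only [tape, List.getElem?_cons_succ, List.getElem?_append, List.length_map,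
      List.getElem?_map]
    split_ifs with h
    · simp only [Option.map_eq_some_iff, reduceCtorEq, and_false, exists_false, false_iff]
      omega
    · rw [List.getElem?_singleton]
      split_ifs with h'
      · simp
        omega
      · simp
        omega

namespace DPWK

variable {Γ M Q₁ Q₂ : Type} {A : DPWK Γ M Q₁ Q₂} {w : List Γ}

theorem StepWith.det {c c₁ c₂ : Config Q₁ Q₂} {m₁ m₂ : ℕ} (h₁ : A.StepWith w c c₁ m₁)
    (h₂ : A.StepWith w c c₂ m₂) : c₁ = c₂ ∧ m₁ = m₂ := by
  obtain ⟨x, y, d, e, hx, hy, ht, hu, hp, hq, -, -, rfl⟩ := h₁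
  obtain ⟨x', y', d', e', hx', hy', ht', hu', hp', hq', -, -, rfl⟩ := h₂
  obtain rfl := Option.some.inj (hx.symm.trans hx')
  obtain rfl := Option.some.inj (hy.symm.trans hy')
  have h1 := Option.some.inj (ht.symm.trans ht')
  have h2 := Option.some.inj (hu.symm.trans hu')
  simp only [Prod.mk.injEq] at h1 h2
  obtain ⟨h1, rfl⟩ := h1
  obtain ⟨h2, rfl⟩ := h2
  obtain ⟨p, i, q, j⟩ := c₁
  obtain ⟨p', i', q', j'⟩ := c₂
  simp only at *
  subst h1 h2 hp hp'
  obtain rfl : j = j' := by omega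
  exact ⟨rfl, trivial⟩

theorem messageCount_le (o : Option M) : messageCount o ≤ 1 := by
  cases o <;> simp [messageCount]

theorem StepWith.count_le {c c' : Config Q₁ Q₂} {m : ℕ} (h : A.StepWith w c c' m) : m ≤ 2 := by
  obtain ⟨x, y, -, -, -, -, -, -, -, -, -, -, rfl⟩ := h
  have h1 := messageCount_le (A.upper.broadcast c.state₁ x)
  have h2 := messageCount_le (A.lower.broadcast c.state₂ y)
  omega

theorem Run.trans {c c' c'' : Config Q₁ Q₂} {m n : ℕ} (h₁ : A.Run w c c' m)
    (h₂ : A.Run w c' c'' n) : A.Run w c c'' (m + n) := by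
  induction h₁ with
  | refl => simpa using h₂
  | cons hs _ ih =>
    rw [add_assoc]
    exact .cons hs (ih h₂)

/-- The run to a halting configuration passes through every reachable configuration. -/
theorem Run.continue {c c₁ c₂ : Config Q₁ Q₂} {m₁ m₂ : ℕ} (h₁ : A.Run w c c₁ m₁)
    (h₂ : A.Run w c c₂ m₂) (hh : A.Halts w c₂) : ∃ n, A.Run w c₁ c₂ n ∧ m₂ = m₁ + n := by
  induction h₁ generalizing m₂ with
  | refl => exact ⟨m₂, h₂, (zero_add _).symm⟩
  | cons hs _ ih =>
    cases h₂ with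
    | refl => exact absurd ⟨_, hs⟩ (hh _)
    | cons hs' h₂ =>
      obtain ⟨rfl, rfl⟩ := hs.det hs'
      obtain ⟨n, hn, rfl⟩ := ih h₂
      exact ⟨n, hn, (add_assoc _ _ _).symm⟩

theorem Run.positions {c c' : Config Q₁ Q₂} {m : ℕ} (h : A.Run w c c' m)
    (h₁ : c.pos₁ < (tape w).length) (h₂ : c.pos₂ < (tape w).length) :
    c.pos₁ ≤ c'.pos₁ ∧ c'.pos₁ < (tape w).length ∧ c'.pos₂ ≤ c.pos₂ := by
  induction h with
  | refl => exact ⟨le_rfl, h₁, le_rfl⟩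
  | cons hs _ ih =>
    obtain ⟨x, y, d, e, -, -, -, -, hp, hq, hl, hl', -⟩ := hs
    have := ih hl hl'
    omega

theorem exists_scans {c : Config Q₁ Q₂} (h₁ : c.pos₁ < (tape w).length)
    (h₂ : c.pos₂ < (tape w).length) : ∃ r, Scans w c r :=
  ⟨((c.state₁, (tape w)[c.pos₁]), (c.state₂, (tape w)[c.pos₂])),
    rfl, List.getElem?_eq_getElem h₁, rfl, List.getElem?_eq_getElem h₂⟩

theorem Run.exists_scans {c : Config Q₁ Q₂} {m : ℕ} (h : A.Run w (A.initial w) c m) :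
    ∃ r, Scans w c r := by
  have h1 := h.positions (by simp [initial, length_tape]) (by simp [initial, length_tape])
  refine DPWK.exists_scans h1.2.1 (h1.2.2.trans_lt ?_)
  simp [initial, length_tape]

/-- Messages are sent at most two at a time, so that counts beyond `k` occur just above `k`. -/
theorem Run.exists_count_le {c c' : Config Q₁ Q₂} {m k : ℕ} (h : A.Run w c c' m) (hk : k < m) :
    ∃ c'' m', A.Run w c c'' m' ∧ k < m' ∧ m' ≤ k + 2 := by
  induction h generalizing k with
  | refl => omega
  | @cons c c' _ m n hs _ ih =>
    by_cases hm : k < m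
    · have h1 := hs.count_le
      exact ⟨c', m, by simpa using Run.cons hs (.refl c'), hm, by omega⟩
    · obtain ⟨c'', m', hr, h1, h2⟩ := ih (k := k - m) (by omega)
      exact ⟨c'', _, .cons hs hr, by omega, by omega⟩

/-- No step is possible in the situation `r`. -/
def HaltsIn (A : DPWK Γ M Q₁ Q₂) (r : Situation Γ Q₁ Q₂) : Prop :=
  ¬ ∃ p d q e, A.upper.trans r.1.1 r.1.2 (A.lower.broadcast r.2.1 r.2.2) = some (p, d) ∧
    A.lower.trans r.2.1 r.2.2 (A.upper.broadcast r.1.1 r.1.2) = some (q, e) ∧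
    (r.1.2 = .rightEnd → d = .stay) ∧ (r.2.2 = .leftEnd → e = .stay)

theorem halts_iff {c : Config Q₁ Q₂} {r : Situation Γ Q₁ Q₂} (hr : Scans w c r) :
    A.Halts w c ↔ A.HaltsIn r := by
  obtain ⟨⟨p, x⟩, ⟨q, y⟩⟩ := r
  obtain ⟨h1, h2, h3, h4⟩ := hr
  simp only at h1 h2 h3 h4
  rw [HaltsIn, Halts, ← not_exists]
  refine not_congr ⟨?_, ?_⟩
  · rintro ⟨c', m, x', y', d, e, hx, hy, ht, hu, hp, hq, hl, hl', -⟩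
    obtain rfl := Option.some.inj (h2.symm.trans hx)
    obtain rfl := Option.some.inj (h4.symm.trans hy)
    subst h1 h3
    refine ⟨_, d, _, e, ht, hu, ?_, ?_⟩
    · rintro rfl
      have := getElem?_tape_eq_rightEnd.1 hx
      rw [length_tape] at hl
      cases d with
      | stay => rfl
      | advance =>
        simp only [Move.dist] at hp
        omega
    · rintro rfl
      have := getElem?_tape_eq_leftEnd.1 hy
      cases e with
      | stay => rfl
      | advance =>
        simp only [Move.dist] at hq
        omega
  · rintro ⟨p', d, q', e, ht, hu, hd, he⟩
    subst h1 h3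
    obtain ⟨hi, -⟩ := List.getElem?_eq_some_iff.1 h2
    obtain ⟨hj, -⟩ := List.getElem?_eq_some_iff.1 h4
    simp only at ht hu hd he
    have hd' : c.pos₁ + d.dist < (tape w).length := by
      cases d with
      | stay => exact hi
      | advance =>
        have : c.pos₁ ≠ w.length + 1 := fun h => by
          rw [getElem?_tape_eq_rightEnd.2 h] at h2
          simpa using hd (Option.some.inj h2).symm
        simp only [Move.dist]
        rw [length_tape] at hi ⊢
        omega
    have he' : e.dist ≤ c.pos₂ := by
      cases e with
      | stay => exact Nat.zero_le _
      | advance =>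
        have : c.pos₂ ≠ 0 := fun h => by
          rw [getElem?_tape_eq_leftEnd.2 h] at h4
          simpa using he (Option.some.inj h4).symm
        simp only [Move.dist]
        omega
    exact ⟨⟨p', c.pos₁ + d.dist, q', c.pos₂ - e.dist⟩, _, x, y, d, e, h2, h4, ht, hu, rfl,
      by simp only; omega, hd', by simp only; omega, rfl⟩

/-- From the situation `r` on, both heads stay where they are forever and no message is sent. -/
def LoopsIn (A : DPWK Γ M Q₁ Q₂) (r : Situation Γ Q₁ Q₂) : Prop :=
  ∃ s : ℕ → Q₁ × Q₂, s 0 = (r.1.1, r.2.1) ∧ ∀ n,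
    A.upper.broadcast (s n).1 r.1.2 = none ∧ A.lower.broadcast (s n).2 r.2.2 = none ∧
    A.upper.trans (s n).1 r.1.2 none = some ((s (n + 1)).1, .stay) ∧
    A.lower.trans (s n).2 r.2.2 none = some ((s (n + 1)).2, .stay)

theorem not_halts_of_loopsIn {r : Situation Γ Q₁ Q₂} (hr : A.LoopsIn r) {c c' : Config Q₁ Q₂}
    {m : ℕ} (hc : Scans w c r) (h : A.Run w c c' m) : ¬ A.Halts w c' := by
  obtain ⟨s, h0, hs⟩ := hr
  obtain ⟨h1, h2, h3, h4⟩ := hc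
  obtain ⟨hi, -⟩ := List.getElem?_eq_some_iff.1 h2
  obtain ⟨hj, -⟩ := List.getElem?_eq_some_iff.1 h4
  have hstep : ∀ n, A.StepWith w ⟨(s n).1, c.pos₁, (s n).2, c.pos₂⟩
      ⟨(s (n + 1)).1, c.pos₁, (s (n + 1)).2, c.pos₂⟩ 0 := fun n => by
    obtain ⟨hb₁, hb₂, ht₁, ht₂⟩ := hs n
    exact ⟨r.1.2, r.2.2, .stay, .stay, h2, h4, by rw [hb₂]; exact ht₁, by rw [hb₁]; exact ht₂,
      rfl, rfl, hi, hj, by rw [hb₁, hb₂]; rfl⟩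
  suffices H : ∃ n, c' = ⟨(s n).1, c.pos₁, (s n).2, c.pos₂⟩ by
    obtain ⟨n, rfl⟩ := H
    exact fun hh => hh _ ⟨_, hstep n⟩
  have H : ∀ c₁, A.Run w c₁ c' m → ∀ n, c₁ = ⟨(s n).1, c.pos₁, (s n).2, c.pos₂⟩ →
      ∃ n, c' = ⟨(s n).1, c.pos₁, (s n).2, c.pos₂⟩ := by
    clear h
    intro c₁ h
    induction h with
    | refl => exact fun n hn => ⟨n, hn⟩
    | cons hs' _ ih =>
      rintro n rfl
      exact ih (n + 1) (hs'.det (hstep n)).1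
  exact H c h 0 (by rw [h0, ← h1, ← h3])

/-- A computation that never halts and sends a bounded number of messages ends in a loop. -/
theorem exists_loopsIn {c : Config Q₁ Q₂} (hc₁ : c.pos₁ < (tape w).length)
    (hc₂ : c.pos₂ < (tape w).length) {k : ℕ}
    (h : ∀ c' m, A.Run w c c' m → ¬ A.Halts w c' ∧ m ≤ k) :
    ∃ c' m r, A.Run w c c' m ∧ Scans w c' r ∧ A.LoopsIn r := by
  classical
  -- The quantity that is maximized is a bounded monotone function of time.
  set S : Set (Config Q₁ Q₂ × ℕ) := {z | A.Run w c z.1 z.2}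
  obtain ⟨⟨c₀, m₀⟩, h₀, hmax⟩ := (measure fun z : Config Q₁ Q₂ × ℕ =>
    (k - z.2) + ((tape w).length - z.1.pos₁) + z.1.pos₂).wf.has_min S ⟨(c, 0), .refl c⟩
  change A.Run w c c₀ m₀ at h₀
  have hp₀ := h₀.positions hc₁ hc₂
  have hl₀ : c₀.pos₂ < (tape w).length := hp₀.2.2.trans_lt hc₂
  have hstay : ∀ c' m, A.Run w c₀ c' m → m = 0 ∧ c'.pos₁ = c₀.pos₁ ∧ c'.pos₂ = c₀.pos₂ := by
    intro c' m hr
    have h1 := h₀.trans hr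
    have h2 : ¬ (k - (m₀ + m)) + ((tape w).length - c'.pos₁) + c'.pos₂ <
      (k - m₀) + ((tape w).length - c₀.pos₁) + c₀.pos₂ := hmax (c', m₀ + m) h1
    have h3 := (h _ _ h1).2
    have h4 := hr.positions hp₀.2.1 hl₀
    omega
  have hnext : ∀ c' m, A.Run w c₀ c' m → ∃ c'', A.StepWith w c' c'' 0 := by
    intro c' m hr
    have h1 := (h _ _ (h₀.trans hr)).1
    simp only [Halts, not_forall, not_not] at h1
    obtain ⟨c'', n, hs⟩ := h1
    have := (hstay _ _ (hr.trans (.cons hs (.refl _)))).1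
    obtain rfl : n = 0 := by omega
    exact ⟨c'', hs⟩
  let next : Config Q₁ Q₂ → Config Q₁ Q₂ := fun c' =>
    if h : ∃ c'', A.StepWith w c' c'' 0 then h.choose else c'
  have hrun : ∀ n, A.Run w c₀ (next^[n] c₀) 0 ∧
      A.StepWith w (next^[n] c₀) (next^[n + 1] c₀) 0 := by
    intro n
    have hs : ∀ c', A.Run w c₀ c' 0 → A.StepWith w c' (next c') 0 := fun c' hr => by
      have h1 := hnext c' 0 hr
      simp only [next, dif_pos h1]
      exact h1.choose_spec
    have hr : A.Run w c₀ (next^[n] c₀) 0 := by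
      induction n with
      | zero => exact .refl _
      | succ n ih =>
        rw [Function.iterate_succ_apply']
        exact ih.trans (.cons (hs _ ih) (.refl _))
    refine ⟨hr, ?_⟩
    rw [Function.iterate_succ_apply']
    exact hs _ hr
  obtain ⟨r, hr⟩ := exists_scans hp₀.2.1 hl₀
  refine ⟨c₀, m₀, r, h₀, hr, fun n => ((next^[n] c₀).state₁, (next^[n] c₀).state₂), ?_, ?_⟩
  · simp [hr.1, hr.2.2.1]
  · intro n
    obtain ⟨-, hx₀, -, hy₀⟩ := hr
    obtain ⟨hrn, hs⟩ := hrun n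
    obtain ⟨-, e₁, e₂⟩ := hstay _ _ hrn
    obtain ⟨-, e₁', e₂'⟩ := hstay _ _ (hrun (n + 1)).1
    obtain ⟨x, y, d, e, hx, hy, ht, hu, hp, hq, -, -, hm⟩ := hs
    rw [e₁] at hx
    rw [e₂] at hy
    obtain rfl := Option.some.inj (hx₀.symm.trans hx)
    obtain rfl := Option.some.inj (hy₀.symm.trans hy)
    have hb₁ := eq_none_of_messageCount (Nat.eq_zero_of_add_eq_zero_right hm.symm)
    have hb₂ := eq_none_of_messageCount (Nat.eq_zero_of_add_eq_zero_left hm.symm)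
    rw [hb₂] at ht
    rw [hb₁] at hu
    have hd : d = .stay := by
      cases d with
      | stay => rfl
      | advance =>
        simp only [Move.dist] at hp
        omega
    have he : e = .stay := by
      cases e with
      | stay => rfl
      | advance =>
        simp only [Move.dist] at hq
        omega
    subst hd he
    exact ⟨hb₁, hb₂, ht, hu⟩

/-- The words on which the situation `r` is reached after exactly `m` messages. -/
def reach (A : DPWK Γ M Q₁ Q₂) (m : ℕ) (r : Situation Γ Q₁ Q₂) : Set (List Γ) :=
  {w | ∃ c, A.Run w (A.initial w) c m ∧ Scans w c r}

/-- At most `k` messages are sent in every accepting computation. -/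
def CommBounded (A : DPWK Γ M Q₁ Q₂) (k : ℕ) : Prop :=
  ∀ w ∈ A.language, ∃ c m, A.Run w (A.initial w) c m ∧ A.AcceptingHalt w c ∧ m ≤ k

theorem exists_reach_of_mem_language {k : ℕ} (hA : A.CommBounded k) (hw : w ∈ A.language) :
    ∃ m r, m ≤ k ∧ w ∈ A.reach m r ∧ A.reach m r ⊆ A.language := by
  obtain ⟨c, m, hrun, ⟨hh, hacc⟩, hm⟩ := hA w hw
  obtain ⟨r, hr⟩ := hrun.exists_scans
  refine ⟨m, r, hm, ⟨c, hrun, hr⟩, ?_⟩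
  rintro w' ⟨c', hrun', hr'⟩
  refine ⟨c', m, hrun', (halts_iff hr').2 ((halts_iff hr).1 hh), ?_⟩
  rwa [hr'.1, hr'.2.2.1, ← hr.1, ← hr.2.2.1]

/-- A word is rejected because too many messages are sent, because the computation halts without
accepting, or because it loops; each of these reasons is visible in a reachable situation. -/
theorem exists_reach_of_notMem_language {k : ℕ} (hA : A.CommBounded k) (hw : w ∉ A.language) :
    ∃ m r, m ≤ k + 2 ∧ w ∈ A.reach m r ∧ A.reach m r ⊆ A.languageᶜ := by
  by_cases hmany : ∃ c m, A.Run w (A.initial w) c m ∧ k < m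
  · obtain ⟨c, m, hrun, hm⟩ := hmany
    obtain ⟨c', m', hrun', hm', hle⟩ := hrun.exists_count_le hm
    obtain ⟨r, hr⟩ := hrun'.exists_scans
    refine ⟨m', r, hle, ⟨c', hrun', hr⟩, ?_⟩
    rintro v ⟨d, hd, -⟩ hv
    obtain ⟨e, n, he, ⟨hh, -⟩, hn⟩ := hA v hv
    obtain ⟨n', -, h⟩ := hd.continue he hh
    omega
  push Not at hmany
  by_cases hhalt : ∃ c m, A.Run w (A.initial w) c m ∧ A.Halts w c
  · obtain ⟨c, m, hrun, hh⟩ := hhalt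
    obtain ⟨r, hr⟩ := hrun.exists_scans
    refine ⟨m, r, (hmany _ _ hrun).trans (by omega), ⟨c, hrun, hr⟩, ?_⟩
    rintro v ⟨d, hd, hdr⟩ hv
    obtain ⟨e, n, he, ⟨hh', hacc⟩, -⟩ := hA v hv
    obtain ⟨n', hn', -⟩ := hd.continue he hh'
    have hde : e = d := by
      cases hn' with
      | refl => rfl
      | cons hs _ => exact absurd ⟨_, hs⟩ ((halts_iff hdr).2 ((halts_iff hr).1 hh) _)
    subst hde
    rw [hdr.1, hdr.2.2.1, ← hr.1, ← hr.2.2.1] at hacc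
    exact hw ⟨c, m, hrun, hh, hacc⟩
  push Not at hhalt
  obtain ⟨c, m, r, hrun, hr, hloop⟩ := exists_loopsIn (A := A) (w := w) (c := A.initial w)
    (by simp [initial, length_tape]) (by simp [initial, length_tape])
    fun c m h => ⟨hhalt c m h, hmany c m h⟩
  refine ⟨m, r, (hmany _ _ hrun).trans (by omega), ⟨c, hrun, hr⟩, ?_⟩
  rintro v ⟨d, hd, hdr⟩ hv
  obtain ⟨e, n, he, ⟨hh, -⟩, -⟩ := hA v hv
  obtain ⟨n', hn', -⟩ := hd.continue he hh
  exact not_halts_of_loopsIn hloop hdr hn' hh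

end DPWK

end WatsonCrick

/-! ### Families of words covered by weighted automata -/

namespace WatsonCrick

/-- The automaton for the tape inscriptions `⊳ a₁ ⋯ aₙ ⊲`. -/
def tapeFilter (Γ : Type) : WeightedNFA (TapeSymbol Γ) Unit (Fin 3) where
  edge i o _ j := (i = 0 ∧ o = some .leftEnd ∧ j = 1) ∨
    (i = 1 ∧ (∃ x, o = some (.letter x)) ∧ j = 1) ∨ (i = 1 ∧ o = some .rightEnd ∧ j = 2)
  start i := i = 0
  final i := i = 2

theorem accepts_tapeFilter {Γ : Type} {l : List (TapeSymbol Γ)} {a : Unit} :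
    (tapeFilter Γ).Accepts l a ↔ ∃ w, l = tape w := by
  constructor
  · rintro ⟨u, t, hu, ht, h⟩
    suffices H : (u = 2 → l = []) ∧ (u = 1 → ∃ w : List Γ, l = w.map .letter ++ [.rightEnd]) ∧
        (u = 0 → ∃ w, l = tape w) from H.2.2 hu
    clear hu
    induction h with
    | nil v =>
      obtain rfl : v = 2 := ht
      simp
    | cons he _ ih =>
      obtain ⟨ih2, ih1, -⟩ := ih ht
      rcases he with ⟨rfl, rfl, rfl⟩ | ⟨rfl, ⟨x, rfl⟩, rfl⟩ | ⟨rfl, rfl, rfl⟩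
      · obtain ⟨w, rfl⟩ := ih1 rfl
        exact ⟨by simp, by simp, fun _ => ⟨w, rfl⟩⟩
      · obtain ⟨w, rfl⟩ := ih1 rfl
        exact ⟨by simp, fun _ => ⟨x :: w, rfl⟩, by simp⟩
      · obtain rfl := ih2 rfl
        exact ⟨by simp, fun _ => ⟨[], rfl⟩, by simp⟩
  · rintro ⟨w, rfl⟩
    have cons : ∀ {x : TapeSymbol Γ} {l : List (TapeSymbol Γ)} {i j : Fin 3},
        (tapeFilter Γ).edge i (some x) () j → (tapeFilter Γ).Path j l () 2 →
        (tapeFilter Γ).Path i (x :: l) () 2 := fun he h => .cons he h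
    refine ⟨0, 2, rfl, rfl, cons (Or.inl ⟨rfl, rfl, rfl⟩) ?_⟩
    induction w with
    | nil => exact cons (Or.inr (Or.inr ⟨rfl, rfl, rfl⟩)) (.nil 2)
    | cons x w ih => exact cons (Or.inr (Or.inl ⟨rfl, ⟨x, rfl⟩, rfl⟩)) ih

namespace WeightedNFA

variable {σ V V₁ V₂ ι ι₁ ι₂ : Type}

theorem Accepts.one_le [Fintype V] {N : WeightedNFA σ (ι → ℤ) V} {n : ℕ}
    (hN : N.BoundedBy n) {l : List σ} {a : ι → ℤ} (h : N.Accepts l a) : 1 ≤ n := by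
  obtain ⟨u, -⟩ := h
  exact (Fintype.card_pos_iff.2 ⟨u⟩).trans_le hN.card_le

theorem BoundedBy.mono [Fintype V] {N : WeightedNFA σ (ι → ℤ) V} {m n : ℕ} (hN : N.BoundedBy m)
    (h : m ≤ n) : N.BoundedBy n :=
  ⟨hN.card_le.trans h, fun u o a v he i => (hN.weight_le u o a v he i).trans (by exact_mod_cast h)⟩

/-- The product with an unweighted automaton. -/
def filter (N₁ : WeightedNFA σ (ι → ℤ) V₁) (N₂ : WeightedNFA σ Unit V₂) :
    WeightedNFA σ (ι → ℤ) (V₁ × V₂) :=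
  N₁.prod N₂ (AddMonoidHom.fst _ _)

theorem accepts_filter {N₁ : WeightedNFA σ (ι → ℤ) V₁} {N₂ : WeightedNFA σ Unit V₂} {l : List σ}
    {a : ι → ℤ} : (N₁.filter N₂).Accepts l a ↔ N₁.Accepts l a ∧ N₂.Accepts l () := by
  rw [filter, accepts_prod]
  constructor
  · rintro ⟨a, b, ha, hb, rfl⟩
    exact ⟨ha, hb⟩
  · rintro ⟨ha, hb⟩
    exact ⟨a, (), ha, hb, rfl⟩

theorem BoundedBy.filter [Fintype V₁] [Fintype V₂] {N₁ : WeightedNFA σ (ι → ℤ) V₁} {m n : ℕ}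
    (hN : N₁.BoundedBy m)
    (N₂ : WeightedNFA σ Unit V₂) (hn : Fintype.card V₂ ≤ n) (h1 : 1 ≤ n) :
    (N₁.filter N₂).BoundedBy (m * n) := by
  refine ⟨?_, fun u o a v he i => ?_⟩
  · rw [Fintype.card_prod]
    exact Nat.mul_le_mul hN.card_le hn
  · have hm : (m : ℤ) ≤ (m * n : ℕ) := by exact_mod_cast Nat.le_mul_of_pos_right m h1
    refine le_trans ?_ hm
    cases he with
    | letter x h₁ h₂ => exact hN.weight_le _ _ _ _ h₁ i
    | left u₂ h₁ => exact hN.weight_le _ _ _ _ h₁ i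
    | right u₁ h₂ => simp

/-- Concatenation of weight vectors. -/
def sumElimHom (ι₁ ι₂ : Type) : (ι₁ → ℤ) × (ι₂ → ℤ) →+ (ι₁ ⊕ ι₂ → ℤ) where
  toFun a := Sum.elim a.1 a.2
  map_zero' := by
    ext i
    cases i <;> rfl
  map_add' a b := by
    ext i
    cases i <;> rfl

/-- The product in which both weights are kept. -/
def inter (N₁ : WeightedNFA σ (ι₁ → ℤ) V₁) (N₂ : WeightedNFA σ (ι₂ → ℤ) V₂) :
    WeightedNFA σ (ι₁ ⊕ ι₂ → ℤ) (V₁ × V₂) :=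
  N₁.prod N₂ (sumElimHom ι₁ ι₂)

theorem accepts_inter {N₁ : WeightedNFA σ (ι₁ → ℤ) V₁} {N₂ : WeightedNFA σ (ι₂ → ℤ) V₂}
    {l : List σ} : (N₁.inter N₂).Accepts l 0 ↔ N₁.Accepts l 0 ∧ N₂.Accepts l 0 := by
  rw [inter, accepts_prod]
  constructor
  · rintro ⟨a, b, ha, hb, h⟩
    have ha0 : a = 0 := funext fun i => (congrFun h (.inl i)).symm
    have hb0 : b = 0 := funext fun i => (congrFun h (.inr i)).symm
    exact ⟨ha0 ▸ ha, hb0 ▸ hb⟩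
  · rintro ⟨ha, hb⟩
    exact ⟨0, 0, ha, hb, (map_zero (sumElimHom ι₁ ι₂)).symm⟩

theorem BoundedBy.inter [Fintype V₁] [Fintype V₂] {N₁ : WeightedNFA σ (ι₁ → ℤ) V₁}
    {N₂ : WeightedNFA σ (ι₂ → ℤ) V₂} {m n : ℕ} (h₁ : N₁.BoundedBy m)
    (h₂ : N₂.BoundedBy n) (hm : 1 ≤ m) (hn : 1 ≤ n) :
    (N₁.inter N₂).BoundedBy (m * n) := by
  refine ⟨?_, fun u o a v he i => ?_⟩
  · rw [Fintype.card_prod]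
    exact Nat.mul_le_mul h₁.card_le h₂.card_le
  · have hm' : (m : ℤ) ≤ (m * n : ℕ) := by exact_mod_cast Nat.le_mul_of_pos_right m hn
    have hn' : (n : ℤ) ≤ (m * n : ℕ) := by exact_mod_cast Nat.le_mul_of_pos_left n hm
    have h0 : (0 : ℤ) ≤ (m * n : ℕ) := Int.natCast_nonneg _
    cases he with
    | letter x h h' =>
      cases i with
      | inl i => exact (h₁.weight_le _ _ _ _ h i).trans hm'
      | inr i => exact (h₂.weight_le _ _ _ _ h' i).trans hn'
    | left u₂ h =>
      cases i with
      | inl i => exact (h₁.weight_le _ _ _ _ h i).trans hm'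
      | inr i => simpa [sumElimHom] using h0
    | right u₁ h =>
      cases i with
      | inl i => simpa [sumElimHom] using h0
      | inr i => exact (h₂.weight_le _ _ _ _ h i).trans hn'

/-- Difference of weight vectors. -/
def subHom (κ : Type) : (κ → ℕ) × (κ → ℕ) →+ (κ → ℤ) where
  toFun a i := (a.1 i : ℤ) - a.2 i
  map_zero' := by
    ext i
    simp
  map_add' a b := by
    ext i
    simp only [Prod.fst_add, Prod.snd_add, Pi.add_apply]
    push_cast
    ring

end WeightedNFA

/-- `L` is a union of languages of automata with `d`-dimensional weights that are bounded by `n`;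
an automaton accepts with weight zero, and reads tape inscriptions. -/
def Covered {Γ : Type} (L : Set (List Γ)) (d n : ℕ) : Prop :=
  ∀ w ∈ L, ∃ (V ι : Type) (_ : Fintype V) (_ : Fintype ι)
    (N : WeightedNFA (TapeSymbol Γ) (ι → ℤ) V), N.BoundedBy n ∧ Fintype.card ι = d ∧
    N.Accepts (tape w) 0 ∧ ∀ v, N.Accepts (tape v) 0 → v ∈ L

namespace Covered

variable {Γ : Type} {L L₁ L₂ : Set (List Γ)} {d n d₁ d₂ n₁ n₂ : ℕ}

theorem mono (h : Covered L d n₁) (hn : n₁ ≤ n₂) : Covered L d n₂ := fun w hw => by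
  obtain ⟨V, ι, _, _, N, hN, h'⟩ := h w hw
  exact ⟨V, ι, _, _, N, hN.mono hn, h'⟩

theorem inter (h₁ : Covered L₁ d₁ n₁) (h₂ : Covered L₂ d₂ n₂) :
    Covered (L₁ ∩ L₂) (d₁ + d₂) (n₁ * n₂) := fun w hw => by
  obtain ⟨V, ι, _, _, N, hN, rfl, hw₁, hL₁⟩ := h₁ w hw.1
  obtain ⟨V', ι', _, _, N', hN', rfl, hw₂, hL₂⟩ := h₂ w hw.2
  refine ⟨V × V', ι ⊕ ι', inferInstance, inferInstance, N.inter N',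
    hN.inter hN' (hw₁.one_le hN) (hw₂.one_le hN'), Fintype.card_sum, ?_, fun v hv => ?_⟩
  · exact WeightedNFA.accepts_inter.2 ⟨hw₁, hw₂⟩
  · have := WeightedNFA.accepts_inter.1 hv
    exact ⟨hL₁ v this.1, hL₂ v this.2⟩

theorem filter (h : Covered L d n) (p : TapeSymbol Γ → Bool) (m : ℕ) :
    Covered {w ∈ L | m ≤ (tape w).countP p} d (n * (m + 1)) := fun w hw => by
  obtain ⟨V, ι, _, _, N, hN, rfl, hw', hL⟩ := h w hw.1
  refine ⟨V × Fin (m + 1), ι, inferInstance, inferInstance,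
    N.filter (WeightedNFA.countFilter p m), hN.filter _ (by simp) (by omega), rfl, ?_,
    fun v hv => ?_⟩
  · exact WeightedNFA.accepts_filter.2 ⟨hw', WeightedNFA.accepts_countFilter.2 hw.2⟩
  · have := WeightedNFA.accepts_filter.1 hv
    exact ⟨hL v this.1, WeightedNFA.accepts_countFilter.1 this.2⟩

/-- The factor `3` is the number of states of the automaton that checks the form of the tape, which
may not be destroyed by pumping. -/
theorem exists_short (h : Covered L d n) {w : List Γ} (hw : w ∈ L) :
    ∃ v ∈ L, v.length ≤ walkBound d (n * 3) := by
  obtain ⟨V, ι, _, _, N, hN, rfl, hw', hL⟩ := h w hw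
  obtain ⟨l, hl, hlen⟩ := (hN.filter (tapeFilter Γ) (n := 3) (by simp) (by omega)).exists_short
    (WeightedNFA.accepts_filter.2 ⟨hw', accepts_tapeFilter.2 ⟨w, rfl⟩⟩)
  obtain ⟨hl₁, hl₂⟩ := WeightedNFA.accepts_filter.1 hl
  obtain ⟨v, rfl⟩ := accepts_tapeFilter.1 hl₂
  rw [length_tape] at hlen
  exact ⟨v, hL v hl₁, by omega⟩

theorem exists_arbitrarily_long (h : Covered L d n) {w : List Γ} (hw : w ∈ L)
    (hlong : walkBound d (n * 3) < w.length) (m : ℕ) : ∃ v ∈ L, m ≤ v.length := by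
  obtain ⟨V, ι, _, _, N, hN, rfl, hw', hL⟩ := h w hw
  obtain ⟨l, hl, hlen⟩ := (hN.filter (tapeFilter Γ) (n := 3) (by simp)
    (by omega)).exists_arbitrarily_long
    (WeightedNFA.accepts_filter.2 ⟨hw', accepts_tapeFilter.2 ⟨w, rfl⟩⟩)
    (by rw [length_tape]; omega) (m + 2)
  obtain ⟨hl₁, hl₂⟩ := WeightedNFA.accepts_filter.1 hl
  obtain ⟨v, rfl⟩ := accepts_tapeFilter.1 hl₂
  rw [length_tape] at hlen
  exact ⟨v, hL v hl₁, by omega⟩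

end Covered

/-! ### Languages of two-party systems are covered -/

section

variable {Γ M Q Q₁ Q₂ R : Type} {K : ℕ}

/-- Tape symbols are letters with two additional elements. -/
def TapeSymbol.equivOption (Γ : Type) : TapeSymbol Γ ≃ Option (Option Γ) where
  toFun
    | .leftEnd => none
    | .rightEnd => some none
    | .letter x => some (some x)
  invFun
    | none => .leftEnd
    | some none => .rightEnd
    | some (some x) => .letter x
  left_inv x := by cases x <;> rfl
  right_inv x := by rcases x with _ | _ | _ <;> rfl

instance [Fintype Γ] : Fintype (TapeSymbol Γ) := Fintype.ofEquiv _ (TapeSymbol.equivOption Γ).symm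

theorem TapeSymbol.card [Fintype Γ] : Fintype.card (TapeSymbol Γ) = Fintype.card Γ + 2 := by
  rw [Fintype.card_congr (TapeSymbol.equivOption Γ)]
  simp

/-- Number of states of the automaton for one component with `q` states, `g` letters, and at most
`K` messages. -/
def componentSize (K q g : ℕ) : ℕ := q * (K + 1) * (g + 2) + 1

theorem card_scanner_states [Fintype Γ] [Fintype Q] :
    Fintype.card (Option ((Q × Fin (K + 1)) × TapeSymbol Γ)) =
      componentSize K (Fintype.card Q) (Fintype.card Γ) := by
  simp [componentSize, TapeSymbol.card]

theorem scanEdge_weight_le {D : Dynamics Γ M Q} {own : R → Q × TapeSymbol Γ}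
    {recv : R → Option M} {cnt num : R → ℕ} {F : Q × Fin (K + 1) → TapeSymbol Γ → Prop} {n : ℕ}
    (h1 : 1 ≤ n) (hn : ∀ r, num r ≤ n) {u v : Option ((Q × Fin (K + 1)) × TapeSymbol Γ)}
    {o : Option (TapeSymbol Γ)} {a : PhaseWeight K}
    (h : ScanEdge (PhaseStep D own recv cnt num) F u o a v) (i) : a i ≤ n := by
  have H : ∀ {s x s' d} {a : PhaseWeight K}, PhaseStep D own recv cnt num s x a s' d → a i ≤ n := by
    intro s x s' d a hT
    cases hT with
    | solo e _ _ =>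
      rw [Pi.single_apply]
      split_ifs <;> omega
    | event r _ _ _ _ =>
      have := hn r
      rw [Pi.single_apply]
      split_ifs <;> omega
  cases h with
  | stay hT => exact H hT
  | advance y hT => exact H hT
  | halt => exact Nat.zero_le _
  | rest => exact Nat.zero_le _

/-- The size of the automata for a system with `q₁` and `q₂` states and `g` letters. -/
def systemSize (K q₁ q₂ g : ℕ) : ℕ := componentSize K q₁ g * componentSize K q₂ g

/-- The automaton guesses the run of the upper component in the order of the tape and that of the
lower component backwards, and its weight is the difference of their weights. -/
theorem DPWK.covered_reach [Fintype Γ] [Fintype Q₁] [Fintype Q₂] (A : DPWK Γ M Q₁ Q₂) {m : ℕ}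
    (hm : m ≤ K) (r : Situation Γ Q₁ Q₂) : Covered (A.reach m r) (2 * (K + 1))
      (systemSize K (Fintype.card Q₁) (Fintype.card Q₂) (Fintype.card Γ)) := by
  classical
  intro w hw
  let num : Situation Γ Q₁ Q₂ → ℕ := fun r => Fintype.equivFin (Situation Γ Q₁ Q₂) r
  have hnum : Function.Injective num :=
    Fin.val_injective.comp (Fintype.equivFin (Situation Γ Q₁ Q₂)).injective
  let e : Fin (K + 1) := ⟨m, by omega⟩
  let N₁ := scanner (A.upperStep (K := K) num) (PhaseStop r.1) (A.upper.start, e)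
  let N₂ := (scanner (A.lowerStep (K := K) num) (PhaseStop r.2) (A.lower.start, e)).reverse
  have hacc : ∀ v, (N₁.prod N₂ (WeightedNFA.subHom _)).Accepts (tape v) 0 ↔ v ∈ A.reach m r := by
    intro v
    have hlen : (tape v).take (v.length + 1 + 1) = tape v := by
      rw [List.take_of_length_le]
      rw [length_tape]
    rw [WeightedNFA.accepts_prod]
    constructor
    · rintro ⟨a, b, ha, hb, hab⟩
      obtain rfl : a = b := funext fun i => by
        have := congrFun hab i
        simp only [WeightedNFA.subHom, AddMonoidHom.coe_mk, ZeroHom.coe_mk, Pi.zero_apply] at this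
        omega
      rw [accepts_scanner] at ha
      rw [WeightedNFA.accepts_reverse, accepts_scanner] at hb
      exact A.exists_run_of_reads hnum ha A.lower.start 0 (v.length + 1) rfl
        (by rw [length_tape]; omega) (by rw [hlen]; exact hb)
    · rintro ⟨c, hrun, hc⟩
      obtain ⟨a, ha, hb⟩ := A.exists_reads_of_run num hrun hc e rfl
      refine ⟨a, a, accepts_scanner.2 ha, ?_, ?_⟩
      · rw [WeightedNFA.accepts_reverse, accepts_scanner]
        simp only [DPWK.initial, hlen] at hb
        exact hb
      · ext i
        simp [WeightedNFA.subHom]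
  refine ⟨_, _, inferInstance, inferInstance, N₁.prod N₂ (WeightedNFA.subHom _), ⟨?_, ?_⟩,
    by simp; ring, (hacc w).2 hw, fun v hv => (hacc v).1 hv⟩
  · rw [Fintype.card_prod, card_scanner_states, card_scanner_states, systemSize]
  · intro u o a v he i
    set S := systemSize K (Fintype.card Q₁) (Fintype.card Q₂) (Fintype.card Γ) with hS
    have h1 : 1 ≤ S := Nat.mul_pos (Nat.succ_pos _) (Nat.succ_pos _)
    have hle : ∀ r, num r ≤ S := fun r => by
      have h2 : num r < Fintype.card (Situation Γ Q₁ Q₂) := Fin.isLt _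
      refine h2.le.trans ?_
      rw [hS, systemSize, Fintype.card_prod, Fintype.card_prod, Fintype.card_prod,
        TapeSymbol.card]
      have H : ∀ q, q * (Fintype.card Γ + 2) ≤ componentSize K q (Fintype.card Γ) := fun q => by
        rw [componentSize]
        refine le_trans (Nat.mul_le_mul_right _ ?_) (Nat.le_succ _)
        exact Nat.le_mul_of_pos_right q (Nat.succ_pos K)
      exact Nat.mul_le_mul (H _) (H _)
    have hb₁ : ∀ {u o a v}, N₁.edge u o a v → a i ≤ S := fun h => scanEdge_weight_le h1 hle h i
    have hb₂ : ∀ {u o a v}, N₂.edge u o a v → a i ≤ S := fun h => scanEdge_weight_le h1 hle h i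
    cases he with
    | letter x h h' =>
      have h2 := hb₁ h
      have h3 := hb₂ h'
      simp only [WeightedNFA.subHom, AddMonoidHom.coe_mk, ZeroHom.coe_mk]
      rw [abs_le]
      omega
    | left u₂ h =>
      have h2 := hb₁ h
      simp only [WeightedNFA.subHom, AddMonoidHom.coe_mk, ZeroHom.coe_mk, Pi.zero_apply]
      rw [abs_le]
      omega
    | right u₁ h =>
      have h2 := hb₂ h
      simp only [WeightedNFA.subHom, AddMonoidHom.coe_mk, ZeroHom.coe_mk, Pi.zero_apply]
      rw [abs_le]
      omega

theorem DPWK.CommBounded.covered_language [Fintype Γ] [Fintype Q₁] [Fintype Q₂]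
    {A : DPWK Γ M Q₁ Q₂} {k : ℕ} (hA : A.CommBounded k) : Covered A.language (2 * (k + 2 + 1))
      (systemSize (k + 2) (Fintype.card Q₁) (Fintype.card Q₂) (Fintype.card Γ)) := by
  intro w hw
  obtain ⟨m, r, hm, hr, hsub⟩ := exists_reach_of_mem_language hA hw
  obtain ⟨V, ι, i₁, i₂, N, hN, hd, hacc, hall⟩ :=
    A.covered_reach (K := k + 2) (by omega) r w hr
  exact ⟨V, ι, i₁, i₂, N, hN, hd, hacc, fun v hv => hsub (hall v hv)⟩

theorem DPWK.CommBounded.covered_compl [Fintype Γ] [Fintype Q₁] [Fintype Q₂]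
    {A : DPWK Γ M Q₁ Q₂} {k : ℕ} (hA : A.CommBounded k) : Covered A.languageᶜ (2 * (k + 2 + 1))
      (systemSize (k + 2) (Fintype.card Q₁) (Fintype.card Q₂) (Fintype.card Γ)) := by
  intro w hw
  obtain ⟨m, r, hm, hr, hsub⟩ := exists_reach_of_notMem_language hA hw
  obtain ⟨V, ι, i₁, i₂, N, hN, hd, hacc, hall⟩ := A.covered_reach hm r w hr
  exact ⟨V, ι, i₁, i₂, N, hN, hd, hacc, fun v hv => hsub (hall v hv)⟩

end

end WatsonCrick

/-! ### Restriction to a smaller alphabet -/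

namespace WatsonCrick

/-- Replace the letter `x` by `φ x` and keep the endmarkers. -/
def TapeSymbol.map {Γ Γ' : Type} (φ : Γ' → Γ) : TapeSymbol Γ' → TapeSymbol Γ
  | leftEnd => leftEnd
  | rightEnd => rightEnd
  | letter x => letter (φ x)

theorem tape_map {Γ Γ' : Type} (φ : Γ' → Γ) (w : List Γ') :
    tape (w.map φ) = (tape w).map (TapeSymbol.map φ) := by
  simp [tape, TapeSymbol.map]

/-- The component that treats the letter `x` as the letter `φ x`. -/
def Component.comap {Γ Γ' M Q : Type} (φ : Γ' → Γ) (A : Component Γ M Q) : Component Γ' M Q where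
  broadcast q x := A.broadcast q (x.map φ)
  trans q x m := A.trans q (x.map φ) m
  start := A.start
  accept := A.accept

namespace DPWK

variable {Γ Γ' M Q₁ Q₂ : Type} {A : DPWK Γ M Q₁ Q₂} {φ : Γ' → Γ} {w : List Γ'}

/-- The system that treats the letter `x` as the letter `φ x`. -/
def comap (φ : Γ' → Γ) (A : DPWK Γ M Q₁ Q₂) : DPWK Γ' M Q₁ Q₂ where
  upper := A.upper.comap φ
  lower := A.lower.comap φ

theorem stepWith_comap {c c' : Config Q₁ Q₂} {m : ℕ} :
    (A.comap φ).StepWith w c c' m ↔ A.StepWith (w.map φ) c c' m := by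
  simp only [StepWith, tape_map, List.getElem?_map, List.length_map]
  constructor
  · rintro ⟨x, y, d, e, hx, hy, h⟩
    exact ⟨x.map φ, y.map φ, d, e, by rw [hx]; rfl, by rw [hy]; rfl, h⟩
  · rintro ⟨x, y, d, e, hx, hy, h⟩
    obtain ⟨x, hx', rfl⟩ := Option.map_eq_some_iff.1 hx
    obtain ⟨y, hy', rfl⟩ := Option.map_eq_some_iff.1 hy
    exact ⟨x, y, d, e, hx', hy', h⟩

theorem run_comap {c c' : Config Q₁ Q₂} {m : ℕ} :
    (A.comap φ).Run w c c' m ↔ A.Run (w.map φ) c c' m := by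
  constructor <;> intro h
  · induction h with
    | refl => exact .refl _
    | cons hs _ ih => exact .cons (stepWith_comap.1 hs) ih
  · induction h with
    | refl => exact .refl _
    | cons hs _ ih => exact .cons (stepWith_comap.2 hs) ih

theorem acceptingHalt_comap {c : Config Q₁ Q₂} :
    (A.comap φ).AcceptingHalt w c ↔ A.AcceptingHalt (w.map φ) c := by
  simp only [AcceptingHalt, Halts, Step, stepWith_comap]
  rfl

theorem initial_comap : (A.comap φ).initial w = A.initial (w.map φ) := by
  simp [initial, comap, Component.comap]

theorem mem_language_comap : w ∈ (A.comap φ).language ↔ w.map φ ∈ A.language := by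
  simp only [language, Set.mem_ofPred_eq, initial_comap, run_comap, acceptingHalt_comap]

theorem CommBounded.comap {k : ℕ} (hA : A.CommBounded k) (φ : Γ' → Γ) :
    (A.comap φ).CommBounded k := by
  intro w hw
  obtain ⟨c, m, h₁, h₂, h₃⟩ := hA _ (mem_language_comap.1 hw)
  exact ⟨c, m, by rw [initial_comap]; exact run_comap.2 h₁, acceptingHalt_comap.2 h₂, h₃⟩

end DPWK

/-! ### Bounds for the words that decide a question -/

namespace System

variable {A B : System} {k : ℕ}

theorem commBounded_of_mem (h : A ∈ revPWK fun _ => k) : A.dpwk.CommBounded k := by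
  obtain ⟨-, R, -, hR⟩ := h
  intro w hw
  obtain ⟨c, m, n, h₁, h₂, h₃, -⟩ := hR w hw
  exact ⟨c, m, h₁, h₂, h₃⟩

/-- The size of the automata for the system `A`. -/
def size (k : ℕ) (A : System) : ℕ :=
  systemSize (k + 2) A.numStates₁ A.numStates₂ A.alphabet.card

theorem covered_language (h : A ∈ revPWK fun _ => k) :
    Covered A.dpwk.language (2 * (k + 2 + 1)) (A.size k) := by
  have := (commBounded_of_mem h).covered_language
  rwa [Fintype.card_fin, Fintype.card_fin, Fintype.card_coe] at this

theorem language_eq_image : A.language = List.map Subtype.val '' A.dpwk.language := by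
  ext w
  simp only [language, Set.mem_ofPred_eq, Set.mem_image, eq_comm]

theorem mem_language_iff {v : List {a // a ∈ A.alphabet}} :
    v.map Subtype.val ∈ A.language ↔ v ∈ A.dpwk.language := by
  rw [language_eq_image]
  exact (List.map_injective_iff.2 Subtype.val_injective).mem_set_image

theorem language_eq_empty_iff (hA : A ∈ revPWK fun _ => k) : A.language = ∅ ↔
    ∀ w, w.length ≤ walkBound (2 * (k + 2 + 1)) (A.size k * 3) → w ∉ A.language := by
  constructor
  · rintro h w - hw
    rw [h] at hw
    exact hw
  · intro h
    rw [Set.eq_empty_iff_forall_notMem]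
    rintro w ⟨v, hv, -⟩
    obtain ⟨u, hu, hlen⟩ := (covered_language hA).exists_short hv
    exact h (u.map Subtype.val) (by simpa using hlen) (mem_language_iff.2 hu)

/-- An infinite language has words longer than the bound `b` for short words, and a shortest such
word is itself bounded. -/
theorem finite_language_iff (hA : A ∈ revPWK fun _ => k) {b : ℕ}
    (hb : b = walkBound (2 * (k + 2 + 1)) (A.size k * 3)) : A.language.Finite ↔
    ∀ w, w.length ≤ walkBound (2 * (k + 2 + 1)) (A.size k * (b + 4) * 3) →
      w ∈ A.language → w.length ≤ b := by
  have hcov := covered_language hA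
  rw [language_eq_image, Set.finite_image_iff
    (List.map_injective_iff.2 Subtype.val_injective).injOn, ← language_eq_image]
  constructor
  · intro hfin w _ hw
    by_contra! hlong
    obtain ⟨v, hv, rfl⟩ := hw
    rw [List.length_map] at hlong
    obtain ⟨n, hn⟩ := (hfin.image List.length).bddAbove
    obtain ⟨u, hu, hlen⟩ := hcov.exists_arbitrarily_long hv (hb ▸ hlong) (n + 1)
    have := hn ⟨u, hu, rfl⟩
    omega
  · intro h
    refine (List.finite_length_le {a // a ∈ A.alphabet} b).subset fun v hv => ?_
    by_contra hlong
    rw [Set.mem_ofPred_eq, not_le] at hlong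
    -- A word has more than `b` letters if its tape has at least `b + 3` symbols.
    obtain ⟨u, ⟨hu, hlen⟩, hshort⟩ := (hcov.filter (fun _ => true) (b + 3)).exists_short
      (w := v) ⟨hv, by simp only [List.countP_true, length_tape]; omega⟩
    simp only [List.countP_true, length_tape] at hlen
    have := h (u.map Subtype.val) (by simpa using hshort) (mem_language_iff.2 hu)
    rw [List.length_map] at this
    omega

/-- A bound for the length of a shortest word that is accepted by one system and not by another,
in terms of their sizes. The second summand concerns words with a letter that is unknown to the
second system. -/
def inclusionBound (k a b : ℕ) : ℕ :=
  walkBound (2 * (k + 2 + 1) + 2 * (k + 2 + 1)) (a * b * 3) +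
    walkBound (2 * (k + 2 + 1)) (a * (1 + 1) * 3)

theorem systemSize_mono {K q₁ q₂ g g' : ℕ} (h : g ≤ g') :
    systemSize K q₁ q₂ g ≤ systemSize K q₁ q₂ g' := by
  unfold systemSize componentSize
  gcongr

/-- A word accepted by `A` only has all its letters in the alphabet of `B`, in which case both
systems can be restricted to the common alphabet, or has a letter that `B` does not know. -/
theorem language_subset_iff (hA : A ∈ revPWK fun _ => k) (hB : B ∈ revPWK fun _ => k) :
    A.language ⊆ B.language ↔ ∀ w, w.length ≤ inclusionBound k (A.size k) (B.size k) →
      w ∈ A.language → w ∈ B.language := by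
  refine ⟨fun h w _ hw => h hw, fun h => ?_⟩
  rintro w ⟨v, hv, rfl⟩
  by_contra hw
  have hfilter := (covered_language hA).filter
    (fun x => match x with
      | .letter a => decide (a.1 ∉ B.alphabet)
      | _ => false) 1
  by_cases hforeign : ∃ a ∈ v, a.1 ∉ B.alphabet
  · obtain ⟨a, hav, ha⟩ := hforeign
    obtain ⟨u, ⟨hu, hcount⟩, hlen⟩ := hfilter.exists_short (w := v)
      ⟨hv, List.countP_pos_iff.2 ⟨.letter a, by simp [tape, hav], by simpa using ha⟩⟩
    obtain ⟨x, hx, hpx⟩ := List.countP_pos_iff.1 hcount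
    have hmem := h (u.map Subtype.val) (by
      rw [List.length_map]
      exact hlen.trans (Nat.le_add_left _ _)) (mem_language_iff.2 hu)
    obtain ⟨u', -, hu'⟩ := hmem
    cases x with
    | leftEnd => simp at hpx
    | rightEnd => simp at hpx
    | letter b =>
      have hb : b ∈ u := by simpa [tape] using hx
      have : b.1 ∈ u'.map Subtype.val := hu' ▸ List.mem_map_of_mem hb
      obtain ⟨c, -, hc⟩ := List.mem_map.1 this
      simp only [decide_eq_true_eq] at hpx
      exact hpx (hc ▸ c.2)
  · push Not at hforeign
    let S := A.alphabet ∩ B.alphabet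
    let φ : {a // a ∈ S} → {a // a ∈ A.alphabet} := fun a => ⟨a.1, (Finset.mem_inter.1 a.2).1⟩
    let ψ : {a // a ∈ S} → {a // a ∈ B.alphabet} := fun a => ⟨a.1, (Finset.mem_inter.1 a.2).2⟩
    have hφ : ∀ u : List {a // a ∈ S}, (u.map φ).map Subtype.val = u.map Subtype.val := fun u => by
      rw [List.map_map]
      rfl
    have hψ : ∀ u : List {a // a ∈ S}, (u.map ψ).map Subtype.val = u.map Subtype.val := fun u => by
      rw [List.map_map]
      rfl
    have hmemA : ∀ u, u ∈ (A.dpwk.comap φ).language ↔ u.map Subtype.val ∈ A.language := fun u => by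
      rw [DPWK.mem_language_comap, ← mem_language_iff, hφ]
    have hmemB : ∀ u, u ∈ (B.dpwk.comap ψ).language ↔ u.map Subtype.val ∈ B.language := fun u => by
      rw [DPWK.mem_language_comap, ← mem_language_iff, hψ]
    have hcovA := ((commBounded_of_mem hA).comap φ).covered_language
    have hcovB := ((commBounded_of_mem hB).comap ψ).covered_compl
    rw [Fintype.card_fin, Fintype.card_fin, Fintype.card_coe] at hcovA hcovB
    have hcov := (hcovA.mono (systemSize_mono (Finset.card_le_card Finset.inter_subset_left))).inter
      (hcovB.mono (systemSize_mono (Finset.card_le_card Finset.inter_subset_right)))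
    let u : List {a // a ∈ S} := v.attach.map fun a =>
      ⟨a.1.1, Finset.mem_inter.2 ⟨a.1.2, hforeign a.1 a.2⟩⟩
    have hu : u.map Subtype.val = v.map Subtype.val := by
      conv_rhs => rw [← List.attach_map_subtype_val v]
      rw [List.map_map, List.map_map]
      rfl
    obtain ⟨t, ⟨htA, htB⟩, hlen⟩ := hcov.exists_short (w := u)
      ⟨(hmemA u).2 (hu ▸ mem_language_iff.2 hv), fun hB => hw (hu ▸ (hmemB u).1 hB)⟩
    refine htB ((hmemB t).2 (h _ ?_ ((hmemA t).1 htA)))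
    rw [List.length_map]
    exact hlen.trans (Nat.le_add_right _ _)

end System

end WatsonCrick

/-! ### Simulation of a system from its description -/

namespace WatsonCrick

theorem lookup_map_of_mem {α β γ : Type} [BEq β] [LawfulBEq β] (f : α → β) (g : α → γ)
    (hf : Function.Injective f) {l : List α} {a : α} (h : a ∈ l) :
    (l.map fun z => (f z, g z)).lookup (f a) = some (g a) := by
  induction l with
  | nil => simp at h
  | cons b l ih =>
    rw [List.map_cons, List.lookup_cons]
    by_cases hab : f a = f b
    · obtain rfl := hf hab
      simp
    · rw [beq_false_of_ne hab]
      refine ih ?_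
      rcases List.mem_cons.1 h with rfl | h
      · exact absurd rfl hab
      · exact h

/-- Look up an entry in the table of the broadcast function. -/
def broadcastCode (C : ComponentCode) (q x : ℕ) : Option ℕ :=
  (C.2.2.2.1.lookup (q, x)).bind id

/-- Look up an entry in the table of the transition function. -/
def transCode (C : ComponentCode) (q x : ℕ) (m : Option ℕ) : Option (ℕ × ℕ) :=
  (C.2.2.2.2.lookup (q, x, m)).bind id

theorem TapeSymbol.code_injective {S : Finset ℕ} :
    Function.Injective (TapeSymbol.code : TapeSymbol {a // a ∈ S} → ℕ) := by
  intro x y h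
  cases x <;> cases y <;> simp only [TapeSymbol.code] at h <;> try omega
  · rfl
  · rfl
  · congr 1
    exact Subtype.ext (by omega)

theorem mem_tapeSymbols {S : Finset ℕ} (x : TapeSymbol {a // a ∈ S}) : x ∈ tapeSymbols S := by
  cases x <;> simp [tapeSymbols]

theorem mem_messageList {m : ℕ} (r : Option (Fin m)) : r ∈ messageList m := by
  cases r <;> simp [messageList]

section

variable {S : Finset ℕ} {m n : ℕ} (A : Component {a // a ∈ S} (Fin m) (Fin n))

theorem broadcastCode_code (q : Fin n) (x : TapeSymbol {a // a ∈ S}) :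
    broadcastCode A.code q x.code = (A.broadcast q x).map Fin.val := by
  have h := lookup_map_of_mem (l := List.finRange n ×ˢ tapeSymbols S)
    (fun z : Fin n × TapeSymbol {a // a ∈ S} => (z.1.val, z.2.code))
    (fun z => (A.broadcast z.1 z.2).map Fin.val)
    (fun z z' h => by
      simp only [Prod.mk.injEq] at h
      exact Prod.ext (Fin.ext h.1) (TapeSymbol.code_injective h.2))
    (a := (q, x)) (List.mem_product.2 ⟨List.mem_finRange q, mem_tapeSymbols x⟩)
  unfold broadcastCode
  exact (congrArg (fun o => o.bind id) h).trans rfl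

theorem transCode_code (q : Fin n) (x : TapeSymbol {a // a ∈ S}) (r : Option (Fin m)) :
    transCode A.code q x.code (r.map Fin.val) =
      (A.trans q x r).map fun z => (z.1.val, z.2.dist) := by
  have h := lookup_map_of_mem (l := List.finRange n ×ˢ tapeSymbols S ×ˢ messageList m)
    (fun z : Fin n × TapeSymbol {a // a ∈ S} × Option (Fin m) =>
      (z.1.val, z.2.1.code, z.2.2.map Fin.val))
    (fun z => (A.trans z.1 z.2.1 z.2.2).map fun z => (z.1.val, z.2.dist))
    (fun z z' h => by
      simp only [Prod.mk.injEq] at h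
      exact Prod.ext (Fin.ext h.1) (Prod.ext (TapeSymbol.code_injective h.2.1)
        (Option.map_injective Fin.val_injective h.2.2)))
    (a := (q, x, r)) (List.mem_product.2 ⟨List.mem_finRange q,
      List.mem_product.2 ⟨mem_tapeSymbols x, mem_messageList r⟩⟩)
  unfold transCode
  exact (congrArg (fun o => o.bind id) h).trans rfl

end

/-- State and position of the upper component, state and position of the lower component. -/
abbrev ConfigCode : Type := ℕ × ℕ × ℕ × ℕ

/-- The states and positions as natural numbers. -/
def Config.code {n₁ n₂ : ℕ} (c : Config (Fin n₁) (Fin n₂)) : ConfigCode :=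
  (c.state₁.val, c.pos₁, c.state₂.val, c.pos₂)

/-- The displacement of the heads at positions `i` and `j` on a tape of length `len`, if it does
not leave the tape; `u` and `v` are the new states and the distances. -/
def moveCode (len i j : ℕ) (u v : ℕ × ℕ) : Option ConfigCode :=
  if i + u.2 < len ∧ v.2 ≤ j then some (u.1, i + u.2, v.1, j - v.2) else none

theorem moveCode_eq_some_iff {len i j : ℕ} {u v : ℕ × ℕ} {z : ConfigCode} :
    moveCode len i j u v = some z ↔
      (i + u.2 < len ∧ v.2 ≤ j) ∧ z = (u.1, i + u.2, v.1, j - v.2) := by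
  unfold moveCode
  split_ifs with h <;> simp [h, eq_comm]

/-- The successor of a configuration on the tape `t`, whose symbols are given by their codes. -/
def stepCode (C : SystemCode) (t : List ℕ) (c : ConfigCode) : Option ConfigCode :=
  (t[c.2.1]?).bind fun x => (t[c.2.2.2]?).bind fun y =>
    (transCode C.2.2.1 c.1 x (broadcastCode C.2.2.2 c.2.2.1 y)).bind fun u =>
      (transCode C.2.2.2 c.2.2.1 y (broadcastCode C.2.2.1 c.1 x)).bind fun v =>
        moveCode t.length c.2.1 c.2.2.2 u v

/-- The codes of the symbols on the tape with the input `w`. -/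
def tapeCode (w : List ℕ) : List ℕ := 0 :: (w.map (· + 2) ++ [1])

theorem tapeCode_map_val {S : Finset ℕ} (v : List {a // a ∈ S}) :
    tapeCode (v.map Subtype.val) = (tape v).map TapeSymbol.code := by
  simp [tapeCode, tape, TapeSymbol.code]

namespace System

variable {A : System}

theorem stepCode_code (A : System) (v : List {a // a ∈ A.alphabet})
    (c : Config (Fin A.numStates₁) (Fin A.numStates₂)) (z : ConfigCode) :
    stepCode A.code (tapeCode (v.map Subtype.val)) c.code = some z ↔
      ∃ c', A.dpwk.Step v c c' ∧ z = c'.code := by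
  rw [tapeCode_map_val]
  simp only [stepCode, List.getElem?_map, Option.bind_eq_some_iff, Option.map_eq_some_iff,
    List.length_map, moveCode_eq_some_iff]
  constructor
  · rintro ⟨_, ⟨x, hx, rfl⟩, _, ⟨y, hy, rfl⟩, u, hu, u', hu', hle, rfl⟩
    simp only [Config.code, code, broadcastCode_code, transCode_code,
      Option.map_eq_some_iff] at hu hu' hx hy hle
    obtain ⟨⟨p, d⟩, ht, rfl⟩ := hu
    obtain ⟨⟨q, e⟩, ht', rfl⟩ := hu'
    obtain ⟨hj, -⟩ := List.getElem?_eq_some_iff.1 hy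
    exact ⟨⟨p, c.pos₁ + d.dist, q, c.pos₂ - e.dist⟩, ⟨_, x, y, d, e, hx, hy, ht, ht', rfl,
      (Nat.sub_add_cancel hle.2).symm, hle.1, (Nat.sub_le _ _).trans_lt hj, rfl⟩, rfl⟩
  · rintro ⟨c', ⟨_, x, y, d, e, hx, hy, ht, ht', hp, hq, hl, -, -⟩, rfl⟩
    refine ⟨_, ⟨x, hx, rfl⟩, _, ⟨y, hy, rfl⟩, (c'.state₁.val, d.dist), ?_,
      (c'.state₂.val, e.dist), ?_, ?_⟩
    · simp only [Config.code, code, broadcastCode_code, transCode_code, ht, Option.map_some]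
    · simp only [Config.code, code, broadcastCode_code, transCode_code, ht', Option.map_some]
    · have h1 : c.pos₁ + d.dist < (tape v).length := hp ▸ hl
      have h2 : e.dist ≤ c.pos₂ := by omega
      refine ⟨⟨h1, h2⟩, ?_⟩
      simp only [Config.code]
      rw [hp, hq, Nat.add_sub_cancel]

/-- The configuration after `n` steps, or the halting configuration if that is reached earlier. -/
def runCode (C : SystemCode) (t : List ℕ) (c : ConfigCode) (n : ℕ) : ConfigCode :=
  Nat.rec c (fun _ c => (stepCode C t c).getD c) n

theorem runCode_eq_iterate (C : SystemCode) (t : List ℕ) (c : ConfigCode) (n : ℕ) :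
    runCode C t c n = (fun c => (stepCode C t c).getD c)^[n] c := by
  induction n with
  | zero => rfl
  | succ n ih =>
    rw [Function.iterate_succ_apply', ← ih]
    rfl

/-- An iteration that reaches a fixed point `z` inside a set of `n` elements does so within `n`
steps. -/
theorem iterate_eq_of_card_le {X : Type} [DecidableEq X] (f : X → X) (s : Finset X) {x z : X}
    {n : ℕ} (hs : ∀ i, f^[i] x ∈ s) (hn : s.card ≤ n) (hz : f z = z) {t : ℕ} (ht : f^[t] x = z) :
    f^[n] x = z := by
  have hfix : ∀ i, f^[i] z = z := fun i => Function.iterate_fixed hz i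
  rcases le_or_gt t n with h | h
  · rw [← Nat.sub_add_cancel h, Function.iterate_add_apply, ht, hfix]
  obtain ⟨i, hi, j, hj, hne, hij⟩ := Finset.exists_ne_map_eq_of_card_lt_of_maps_to
    (s := Finset.range (n + 1)) (t := s) (f := fun i => f^[i] x) (by simpa using by omega)
    (fun i _ => hs i)
  wlog hlt : i < j generalizing i j
  · exact this j hj i hi hne.symm hij.symm (lt_of_le_of_ne (not_lt.1 hlt) hne.symm)
  simp only [Finset.mem_range] at hi hj
  have hper : ∀ k, f^[k * (j - i)] (f^[i] x) = f^[i] x := by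
    intro k
    induction k with
    | zero => simp
    | succ k ih =>
      rw [Nat.succ_mul, Function.iterate_add_apply, ← Function.iterate_add_apply f (j - i) i,
        Nat.sub_add_cancel hlt.le, ← hij, ih]
  have hiz : f^[i] x = z := by
    have h1 : t ≤ t * (j - i) + i :=
      (Nat.le_mul_of_pos_right t (by omega)).trans (Nat.le_add_right _ _)
    rw [← hper t, ← Function.iterate_add_apply, ← Nat.sub_add_cancel h1,
      Function.iterate_add_apply, ht, hfix]
  rw [← Nat.sub_add_cancel (by omega : i ≤ n), Function.iterate_add_apply, hiz, hfix]

/-- Number of configurations on an input of length `n`. -/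
def numConfigs (C : SystemCode) (n : ℕ) : ℕ :=
  C.2.2.1.1 * ((n + 2) * (C.2.2.2.1 * (n + 2)))

/-- The configuration in which a simulation that is long enough ends. -/
def lastCode (C : SystemCode) (w : List ℕ) : ConfigCode :=
  runCode C (tapeCode w) (C.2.2.1.2.1, 0, C.2.2.2.2.1, w.length + 1) (numConfigs C w.length)

/-- The system with description `C` accepts the word `w`. -/
def AcceptsCode (C : SystemCode) (w : List ℕ) : Prop :=
  (∀ a ∈ w, a ∈ C.1) ∧ stepCode C (tapeCode w) (lastCode C w) = none ∧
    ((lastCode C w).1 ∈ C.2.2.1.2.2.1 ∨ (lastCode C w).2.2.1 ∈ C.2.2.2.2.2.1)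

theorem exists_run_runCode (A : System) (v : List {a // a ∈ A.alphabet}) (n : ℕ) :
    ∃ c m, A.dpwk.Run v (A.dpwk.initial v) c m ∧
      runCode A.code (tapeCode (v.map Subtype.val)) (A.dpwk.initial v).code n = c.code := by
  induction n with
  | zero => exact ⟨_, 0, .refl _, rfl⟩
  | succ n ih =>
    obtain ⟨c, m, hrun, hc⟩ := ih
    change ∃ c m, _ ∧ (stepCode A.code _ (runCode A.code _ _ n)).getD (runCode A.code _ _ n) =
      Config.code c
    rw [hc]
    cases h : stepCode A.code (tapeCode (v.map Subtype.val)) c.code with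
    | none => exact ⟨c, m, hrun, rfl⟩
    | some z =>
      obtain ⟨c', ⟨m', hs⟩, rfl⟩ := (stepCode_code A v c z).1 h
      exact ⟨c', _, hrun.trans (.cons hs (.refl _)), rfl⟩

theorem exists_runCode_of_run (A : System) (v : List {a // a ∈ A.alphabet})
    {c c' : Config (Fin A.numStates₁) (Fin A.numStates₂)} {m : ℕ} (h : A.dpwk.Run v c c' m) :
    ∃ n, (fun c => (stepCode A.code (tapeCode (v.map Subtype.val)) c).getD c)^[n] c.code =
      c'.code := by
  induction h with
  | refl => exact ⟨0, rfl⟩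
  | @cons c c' _ m _ hs _ ih =>
    obtain ⟨n, hn⟩ := ih
    refine ⟨n + 1, ?_⟩
    rw [Function.iterate_succ_apply, (stepCode_code A v c c'.code).2 ⟨c', ⟨m, hs⟩, rfl⟩]
    exact hn

theorem stepCode_eq_none_iff (A : System) (v : List {a // a ∈ A.alphabet})
    (c : Config (Fin A.numStates₁) (Fin A.numStates₂)) :
    stepCode A.code (tapeCode (v.map Subtype.val)) c.code = none ↔ A.dpwk.Halts v c := by
  rw [Option.eq_none_iff_forall_ne_some]
  constructor
  · intro h c' hs
    exact h c'.code ((stepCode_code A v c _).2 ⟨c', hs, rfl⟩)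
  · intro h z hz
    obtain ⟨c', hs, -⟩ := (stepCode_code A v c z).1 hz
    exact h c' hs

theorem runCode_mem_configs (A : System) (v : List {a // a ∈ A.alphabet}) (n : ℕ) :
    runCode A.code (tapeCode (v.map Subtype.val)) (A.dpwk.initial v).code n ∈
      Finset.range A.numStates₁ ×ˢ Finset.range (v.length + 2) ×ˢ Finset.range A.numStates₂ ×ˢ
        Finset.range (v.length + 2) := by
  obtain ⟨c, m, hrun, hc⟩ := exists_run_runCode A v n
  have hpos := hrun.positions (by simp [DPWK.initial, length_tape])
    (by simp [DPWK.initial, length_tape])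
  rw [length_tape] at hpos
  have hpos₂ : c.pos₂ ≤ v.length + 1 := hpos.2.2
  rw [hc]
  simp only [Config.code, Finset.mem_product, Finset.mem_range]
  exact ⟨c.state₁.2, hpos.2.1, c.state₂.2, by omega⟩

theorem lastCode_code (A : System) (v : List {a // a ∈ A.alphabet}) :
    lastCode A.code (v.map Subtype.val) = runCode A.code (tapeCode (v.map Subtype.val))
      (A.dpwk.initial v).code (numConfigs A.code v.length) := by
  simp [lastCode, Config.code, DPWK.initial, code, Component.code]

theorem acceptsCode_map_val (A : System) (v : List {a // a ∈ A.alphabet}) :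
    AcceptsCode A.code (v.map Subtype.val) ↔ v ∈ A.dpwk.language := by
  have hmem₁ : ∀ q : Fin A.numStates₁, q.val ∈ A.code.2.2.1.2.2.1 ↔ q ∈ A.dpwk.upper.accept :=
    fun q => by simp [code, Component.code, Fin.val_inj]
  have hmem₂ : ∀ q : Fin A.numStates₂, q.val ∈ A.code.2.2.2.2.2.1 ↔ q ∈ A.dpwk.lower.accept :=
    fun q => by simp [code, Component.code, Fin.val_inj]
  have hw : ∀ a ∈ v.map Subtype.val, a ∈ A.code.1 := fun a ha => by
    obtain ⟨b, -, rfl⟩ := List.mem_map.1 ha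
    simp [code]
  rw [AcceptsCode, lastCode_code]
  constructor
  · rintro ⟨-, hh, hacc⟩
    obtain ⟨c, m, hrun, hc⟩ := exists_run_runCode A v (numConfigs A.code v.length)
    rw [hc] at hh hacc
    exact ⟨c, m, hrun, (stepCode_eq_none_iff A v c).1 hh,
      hacc.imp (hmem₁ _).1 (hmem₂ _).1⟩
  · rintro ⟨c, m, hrun, hh, hacc⟩
    have hnone := (stepCode_eq_none_iff A v c).2 hh
    obtain ⟨n, hn⟩ := exists_runCode_of_run A v hrun
    have hlast : runCode A.code (tapeCode (v.map Subtype.val)) (A.dpwk.initial v).code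
        (numConfigs A.code v.length) = c.code := by
      rw [runCode_eq_iterate]
      refine iterate_eq_of_card_le _ (Finset.range A.numStates₁ ×ˢ Finset.range (v.length + 2) ×ˢ
        Finset.range A.numStates₂ ×ˢ Finset.range (v.length + 2)) (fun i => ?_) (le_of_eq ?_)
        ((congrArg (fun o => o.getD c.code) hnone).trans rfl) hn
      · rw [← runCode_eq_iterate]
        exact runCode_mem_configs A v i
      · simp only [Finset.card_product, Finset.card_range]
        rfl
    rw [hlast]
    exact ⟨hw, hnone, hacc.imp (hmem₁ _).2 (hmem₂ _).2⟩

theorem acceptsCode_iff (A : System) (w : List ℕ) : AcceptsCode A.code w ↔ w ∈ A.language := by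
  by_cases hw : ∀ a ∈ w, a ∈ A.alphabet
  · obtain ⟨v, rfl⟩ : ∃ v : List {a // a ∈ A.alphabet}, v.map Subtype.val = w :=
      ⟨w.attach.map fun a => ⟨a.1, hw a.1 a.2⟩, by simp [List.map_map, Function.comp_def]⟩
    rw [acceptsCode_map_val, mem_language_iff]
  · refine iff_of_false (fun h => hw fun a ha => ?_) ?_
    · simpa [code] using h.1 a ha
    · rintro ⟨v, -, rfl⟩
      refine hw fun a ha => ?_
      obtain ⟨b, -, rfl⟩ := List.mem_map.1 ha
      exact b.2

end System

end WatsonCrick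

/-! ### Primitive recursiveness of the decision procedures -/

namespace WatsonCrick

open Primrec

theorem primrec_leftoverBound : Primrec leftoverBound := by
  have h2 : Primrec fun C : ℕ => C * C := nat_mul.comp .id .id
  exact nat_add.comp (nat_add.comp .id h2) (nat_mul.comp h2 .id)

theorem primrec_zeroSumBound (d : ℕ) : Primrec (zeroSumBound d) := by
  induction d with
  | zero => exact .const 0
  | succ d ih =>
    have h1 : Primrec fun C : ℕ => 2 * C + 1 :=
      nat_add.comp (nat_mul.comp (.const 2) .id) (.const 1)
    have h2 : Primrec fun C : ℕ => (2 * C + 1) * C + C + leftoverBound C * C :=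
      nat_add.comp (nat_add.comp (nat_mul.comp h1 .id) .id) (nat_mul.comp primrec_leftoverBound .id)
    exact nat_add.comp primrec_leftoverBound (nat_mul.comp h1 (ih.comp h2))

theorem primrec_walkBound (d : ℕ) : Primrec (walkBound d) := by
  have h1 : Primrec fun n : ℕ => (n + 1) * (n + 1) := nat_mul.comp .succ .succ
  exact nat_add.comp h1 (nat_mul.comp .id ((primrec_zeroSumBound d).comp (nat_mul.comp h1 .id)))

theorem primrec_lookup {α β : Type} [Primcodable α] [Primcodable β] [DecidableEq α] [i : BEq α]
    [LawfulBEq α] : Primrec₂ (List.lookup : α → List (α × β) → Option β) := by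
  obtain rfl := lawful_beq_subsingleton i instBEqOfDecidableEq
  exact listLookup

theorem primrec_broadcastCode :
    Primrec fun a : ComponentCode × ℕ × ℕ => broadcastCode a.1 a.2.1 a.2.2 := by
  have h : Primrec fun a : ComponentCode × ℕ × ℕ => a.1.2.2.2.1.lookup a.2 :=
    primrec_lookup.comp snd (fst.comp (snd.comp (snd.comp (snd.comp fst))))
  exact option_bind h snd

theorem primrec_transCode :
    Primrec fun a : ComponentCode × ℕ × ℕ × Option ℕ => transCode a.1 a.2.1 a.2.2.1 a.2.2.2 := by
  have h : Primrec fun a : ComponentCode × ℕ × ℕ × Option ℕ => a.1.2.2.2.2.lookup a.2 :=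
    primrec_lookup.comp snd (snd.comp (snd.comp (snd.comp (snd.comp fst))))
  exact option_bind h snd

theorem primrec_moveCode :
    Primrec fun a : (ℕ × ℕ × ℕ) × (ℕ × ℕ) × (ℕ × ℕ) =>
      moveCode a.1.1 a.1.2.1 a.1.2.2 a.2.1 a.2.2 := by
  have hlen : Primrec fun a : (ℕ × ℕ × ℕ) × (ℕ × ℕ) × (ℕ × ℕ) => a.1.1 := fst.comp fst
  have hi : Primrec fun a : (ℕ × ℕ × ℕ) × (ℕ × ℕ) × (ℕ × ℕ) => a.1.2.1 :=
    fst.comp (snd.comp fst)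
  have hj : Primrec fun a : (ℕ × ℕ × ℕ) × (ℕ × ℕ) × (ℕ × ℕ) => a.1.2.2 :=
    snd.comp (snd.comp fst)
  have hu : Primrec fun a : (ℕ × ℕ × ℕ) × (ℕ × ℕ) × (ℕ × ℕ) => a.2.1 := fst.comp snd
  have hv : Primrec fun a : (ℕ × ℕ × ℕ) × (ℕ × ℕ) × (ℕ × ℕ) => a.2.2 := snd.comp snd
  have hi' := nat_add.comp hi (snd.comp hu)
  exact ite ((nat_lt.comp hi' hlen).and (nat_le.comp (snd.comp hv) hj))
    (option_some.comp ((fst.comp hu).pair (hi'.pair ((fst.comp hv).pair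
      (nat_sub.comp hj (snd.comp hv)))))) (.const none)

section

variable {α : Type} [Primcodable α]

theorem primrec_transCode_broadcastCode {U L : α → ComponentCode} {p q x y : α → ℕ}
    (hU : Primrec U) (hL : Primrec L) (hp : Primrec p) (hq : Primrec q) (hx : Primrec x)
    (hy : Primrec y) :
    Primrec fun a => transCode (U a) (p a) (x a) (broadcastCode (L a) (q a) (y a)) :=
  primrec_transCode.comp (hU.pair (hp.pair (hx.pair
    (primrec_broadcastCode.comp (hL.pair (hq.pair hy))))))

theorem primrec_stepCode {C : α → SystemCode} {t : α → List ℕ} {c : α → ConfigCode}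
    (hC : Primrec C) (ht : Primrec t) (hc : Primrec c) :
    Primrec fun a => stepCode (C a) (t a) (c a) := by
  have hp : Primrec fun a => (c a).1 := fst.comp hc
  have hi : Primrec fun a => (c a).2.1 := fst.comp (snd.comp hc)
  have hq : Primrec fun a => (c a).2.2.1 := fst.comp (snd.comp (snd.comp hc))
  have hj : Primrec fun a => (c a).2.2.2 := snd.comp (snd.comp (snd.comp hc))
  have hU : Primrec fun a => (C a).2.2.1 := fst.comp (snd.comp (snd.comp hC))
  have hL : Primrec fun a => (C a).2.2.2 := snd.comp (snd.comp (snd.comp hC))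
  -- The variables bound by the four nested `Option.bind`s are added to `a : α` one at a time.
  have h₁ : Primrec fun b : α × ℕ => b.1 := fst
  have h₂ : Primrec fun b : (α × ℕ) × ℕ => b.1.1 := fst.comp fst
  have h₃ : Primrec fun b : ((α × ℕ) × ℕ) × (ℕ × ℕ) => b.1.1.1 := h₂.comp fst
  have h₄ : Primrec fun b : (((α × ℕ) × ℕ) × (ℕ × ℕ)) × (ℕ × ℕ) => b.1.1.1.1 := h₃.comp fst
  have hu := primrec_transCode_broadcastCode (hU.comp h₂) (hL.comp h₂) (hp.comp h₂) (hq.comp h₂)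
    (snd.comp fst) snd
  have hv := primrec_transCode_broadcastCode (hL.comp h₃) (hU.comp h₃) (hq.comp h₃) (hp.comp h₃)
    (snd.comp fst) (snd.comp (fst.comp fst))
  have hm := primrec_moveCode.comp ((((list_length.comp ht).comp h₄).pair
    ((hi.comp h₄).pair (hj.comp h₄))).pair ((snd.comp fst).pair snd))
  exact option_bind (list_getElem?.comp ht hi) (option_bind
    (list_getElem?.comp (ht.comp h₁) (hj.comp h₁))
    (option_bind hu (option_bind hv hm.to₂).to₂).to₂).to₂

end

theorem primrec_tapeCode : Primrec tapeCode := by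
  have h : Primrec₂ fun (_ : List ℕ) (a : ℕ) => a + 2 := nat_add.comp snd (.const 2)
  exact list_cons.comp (.const 0) (list_append.comp (list_map .id h) (.const [1]))

namespace System

theorem primrec_runCode : Primrec fun a : (SystemCode × List ℕ) × ConfigCode × ℕ =>
    runCode a.1.1 a.1.2 a.2.1 a.2.2 := by
  have h : Primrec₂ fun (a : (SystemCode × List ℕ) × ConfigCode × ℕ) (z : ℕ × ConfigCode) =>
      (stepCode a.1.1 a.1.2 z.2).getD z.2 :=
    option_getD.comp (primrec_stepCode (fst.comp (fst.comp fst)) (snd.comp (fst.comp fst))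
      (snd.comp snd)) (snd.comp snd)
  exact nat_rec' (snd.comp snd) (fst.comp snd) h

theorem primrec_numConfigs : Primrec fun a : SystemCode × ℕ => numConfigs a.1 a.2 := by
  have hU : Primrec fun a : SystemCode × ℕ => a.1.2.2.1.1 :=
    fst.comp (fst.comp (snd.comp (snd.comp fst)))
  have hL : Primrec fun a : SystemCode × ℕ => a.1.2.2.2.1 :=
    fst.comp (snd.comp (snd.comp (snd.comp fst)))
  have hn : Primrec fun a : SystemCode × ℕ => a.2 + 2 := nat_add.comp snd (.const 2)
  exact nat_mul.comp hU (nat_mul.comp hn (nat_mul.comp hL hn))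

theorem primrec_lastCode : Primrec fun a : SystemCode × List ℕ => lastCode a.1 a.2 := by
  have hlen : Primrec fun a : SystemCode × List ℕ => a.2.length := list_length.comp snd
  have hU : Primrec fun a : SystemCode × List ℕ => a.1.2.2.1.2.1 :=
    fst.comp (snd.comp (fst.comp (snd.comp (snd.comp fst))))
  have hL : Primrec fun a : SystemCode × List ℕ => a.1.2.2.2.2.1 :=
    fst.comp (snd.comp (snd.comp (snd.comp (snd.comp fst))))
  exact primrec_runCode.comp ((fst.pair (primrec_tapeCode.comp snd)).pair
    ((hU.pair ((Primrec.const 0).pair (hL.pair (succ.comp hlen)))).pair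
      (primrec_numConfigs.comp (fst.pair hlen))))

theorem primrecRel_mem : PrimrecRel fun (l : List ℕ) (a : ℕ) => a ∈ l :=
  (PrimrecRel.exists_mem_list (R := fun a b : ℕ => a = b) Primrec.eq).of_eq fun l a => by simp

theorem primrecRel_acceptsCode : PrimrecRel AcceptsCode := by
  have hlast := primrec_lastCode
  have h1 : PrimrecPred fun a : SystemCode × List ℕ => ∀ x ∈ a.2, x ∈ a.1.1 :=
    (PrimrecRel.forall_mem_list primrecRel_mem.swap).comp snd (fst.comp fst)
  have h2 : PrimrecPred fun a : SystemCode × List ℕ =>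
      stepCode a.1 (tapeCode a.2) (lastCode a.1 a.2) = none :=
    Primrec.eq.comp (primrec_stepCode fst (primrec_tapeCode.comp snd) hlast)
      (.const none)
  have h3 : PrimrecPred fun a : SystemCode × List ℕ =>
      (lastCode a.1 a.2).1 ∈ a.1.2.2.1.2.2.1 :=
    primrecRel_mem.comp (fst.comp (snd.comp (snd.comp (fst.comp (snd.comp (snd.comp fst))))))
      (fst.comp hlast)
  have h4 : PrimrecPred fun a : SystemCode × List ℕ =>
      (lastCode a.1 a.2).2.2.1 ∈ a.1.2.2.2.2.2.1 :=
    primrecRel_mem.comp (fst.comp (snd.comp (snd.comp (snd.comp (snd.comp (snd.comp fst))))))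
      (fst.comp (snd.comp (snd.comp hlast)))
  exact h1.and (h2.and (h3.or h4))

/-- The words of length at most `n` over the letters in `l`. -/
def wordsUpTo (l : List ℕ) (n : ℕ) : List (List ℕ) :=
  Nat.rec [[]] (fun _ ws => [] :: ws.flatMap fun w => l.map fun a => a :: w) n

theorem mem_wordsUpTo {l : List ℕ} {n : ℕ} {w : List ℕ} :
    w ∈ wordsUpTo l n ↔ w.length ≤ n ∧ ∀ a ∈ w, a ∈ l := by
  induction n generalizing w with
  | zero =>
    change w ∈ [[]] ↔ _
    cases w <;> simp
  | succ n ih =>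
    change w ∈ [] :: (wordsUpTo l n).flatMap (fun w => l.map fun a => a :: w) ↔ _
    cases w with
    | nil => simp
    | cons a w =>
      simp only [List.mem_cons, reduceCtorEq, List.mem_flatMap, List.mem_map, List.cons.injEq,
        false_or, List.length_cons, Nat.add_le_add_iff_right, forall_eq_or_imp]
      constructor
      · rintro ⟨v, hv, b, hb, rfl, rfl⟩
        have := ih.1 hv
        exact ⟨this.1, hb, this.2⟩
      · rintro ⟨h1, h2, h3⟩
        exact ⟨w, ih.2 ⟨h1, h3⟩, a, h2, rfl, rfl⟩

theorem primrec_wordsUpTo : Primrec fun a : List ℕ × ℕ => wordsUpTo a.1 a.2 := by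
  have h1 : Primrec₂ fun (z : (List ℕ × ℕ) × ℕ × List (List ℕ)) (w : List ℕ) =>
      z.1.1.map fun a => a :: w :=
    list_map (fst.comp (fst.comp fst)) (list_cons.comp snd (snd.comp fst)).to₂
  have h2 : Primrec₂ fun (a : List ℕ × ℕ) (z : ℕ × List (List ℕ)) =>
      [] :: z.2.flatMap fun w => a.1.map fun a => a :: w :=
    list_cons.comp (.const []) (list_flatMap (snd.comp snd) h1)
  exact nat_rec' snd (.const [[]]) h2

theorem primrecPred_forall_words {α : Type} [Primcodable α] {C : α → SystemCode} (hC : Primrec C)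
    {test : α → List ℕ → Prop} (htest : PrimrecRel test) {bound : α → ℕ} (hbound : Primrec bound) :
    PrimrecPred fun c => ∀ w : List ℕ, w.length ≤ bound c → (∀ a ∈ w, a ∈ (C c).1) → test c w := by
  have h : PrimrecPred fun c => ∀ w ∈ wordsUpTo (C c).1 (bound c), test c w :=
    (PrimrecRel.forall_mem_list htest.swap).comp
      (primrec_wordsUpTo.comp ((fst.comp hC).pair hbound)) .id
  exact h.of_eq fun c => by simp only [mem_wordsUpTo, and_imp]

theorem mem_code_fst {A : System} {a : ℕ} : a ∈ A.code.1 ↔ a ∈ A.alphabet := by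
  simp [code]

/-- A primitive recursive property of words, of which only words over the alphabet of the system
and up to a primitive recursive length have to be tested, yields a decision procedure. -/
theorem decidableFor_of_forall {C : Set System} {P : System → Prop}
    {test : SystemCode → List ℕ → Prop} (htest : PrimrecRel test)
    {bound : SystemCode → ℕ} (hbound : Primrec bound)
    (h : ∀ A ∈ C, P A ↔ ∀ w, w.length ≤ bound A.code →
      (∀ a ∈ w, a ∈ A.alphabet) → test A.code w) : DecidableFor C P := by
  classical
  refine ⟨_, (primrecPred_forall_words .id htest hbound).decide.to_comp, fun A hA => ?_⟩
  rw [decide_eq_true_iff, h A hA]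
  simp only [id, mem_code_fst]

/-- Pairs of descriptions are encoded by pairing the codes of their components. -/
local instance instPrimcodablePair : Primcodable (SystemCode × SystemCode) := Primcodable.prod

/-- Instance search finds `Primcodable.ofDenumerable` for pairs of descriptions; the code that it
gives is the usual one for pairs. -/
theorem ofDenumerable_systemCode_prod :
    Primcodable.ofDenumerable (SystemCode × SystemCode) = instPrimcodablePair := rfl

theorem decidableFor₂_iff {C : Set System} {P : System → System → Prop} :
    DecidableFor₂ C P ↔ ∃ f : SystemCode × SystemCode → Bool, Computable f ∧
      ∀ A ∈ C, ∀ B ∈ C, (f (A.code, B.code) = true ↔ P A B) := by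
  rw [← ofDenumerable_systemCode_prod]
  rfl

/-- The analogue of `decidableFor_of_forall` for relations between two systems. -/
theorem decidableFor₂_of_forall {C : Set System} {P : System → System → Prop}
    {test : SystemCode × SystemCode → List ℕ → Prop} (htest : PrimrecRel test)
    {bound : SystemCode × SystemCode → ℕ} (hbound : Primrec bound)
    (h : ∀ A ∈ C, ∀ B ∈ C, P A B ↔ ∀ w, w.length ≤ bound (A.code, B.code) →
      (∀ a ∈ w, a ∈ A.alphabet) → test (A.code, B.code) w) : DecidableFor₂ C P := by
  classical
  refine decidableFor₂_iff.2
    ⟨_, (primrecPred_forall_words fst htest hbound).decide.to_comp, fun A hA B hB => ?_⟩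
  rw [decide_eq_true_iff, h A hA B hB]
  simp only [mem_code_fst]

/-- The size of the automata for a system with description `C`. -/
def sizeCode (k : ℕ) (C : SystemCode) : ℕ :=
  systemSize (k + 2) C.2.2.1.1 C.2.2.2.1 C.1.length

theorem sizeCode_code (k : ℕ) (A : System) : sizeCode k A.code = A.size k := by
  simp [sizeCode, size, code, Component.code]

theorem primrec_sizeCode (k : ℕ) : Primrec (sizeCode k) := by
  have hg : Primrec fun C : SystemCode => C.1.length + 2 :=
    nat_add.comp (list_length.comp fst) (.const 2)
  have hU : Primrec fun C : SystemCode => C.2.2.1.1 := fst.comp (fst.comp (snd.comp snd))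
  have hL : Primrec fun C : SystemCode => C.2.2.2.1 := fst.comp (snd.comp (snd.comp snd))
  have hs : ∀ {q : SystemCode → ℕ}, Primrec q →
      Primrec fun C : SystemCode => componentSize (k + 2) (q C) C.1.length := fun hq =>
    succ.comp (nat_mul.comp (nat_mul.comp hq (.const (k + 2 + 1))) hg)
  exact nat_mul.comp (hs hU) (hs hL)

variable (k : ℕ)

theorem mem_alphabet_of_mem_language {A : System} {w : List ℕ} (h : w ∈ A.language) :
    ∀ a ∈ w, a ∈ A.alphabet := by
  obtain ⟨v, -, rfl⟩ := h
  intro a ha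
  obtain ⟨b, -, rfl⟩ := List.mem_map.1 ha
  exact b.2

theorem decidableFor_empty :
    DecidableFor (revPWK fun _ => k) fun A => A.language = ∅ := by
  refine decidableFor_of_forall (test := fun c w => ¬ AcceptsCode c w)
    (bound := fun c => walkBound (2 * (k + 2 + 1)) (sizeCode k c * 3))
    primrecRel_acceptsCode.not
    ((primrec_walkBound _).comp (nat_mul.comp (primrec_sizeCode k) (.const 3))) fun A hA => ?_
  simp only [acceptsCode_iff, sizeCode_code]
  rw [language_eq_empty_iff hA]
  exact forall₂_congr fun w _ =>
    ⟨fun h _ => h, fun h hw => h (mem_alphabet_of_mem_language hw) hw⟩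

theorem decidableFor_finite :
    DecidableFor (revPWK fun _ => k) fun A => A.language.Finite := by
  obtain ⟨b, hb, hb'⟩ : ∃ b : SystemCode → ℕ, Primrec b ∧
      ∀ c, b c = walkBound (2 * (k + 2 + 1)) (sizeCode k c * 3) :=
    ⟨_, (primrec_walkBound _).comp (nat_mul.comp (primrec_sizeCode k) (.const 3)), fun _ => rfl⟩
  have hlen : PrimrecRel fun (c : SystemCode) (w : List ℕ) => w.length ≤ b c :=
    nat_le.comp (list_length.comp snd) (hb.comp fst)
  have hbound : Primrec fun c =>
      walkBound (2 * (k + 2 + 1)) (sizeCode k c * (b c + 4) * 3) :=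
    (primrec_walkBound _).comp (nat_mul.comp
      (nat_mul.comp (primrec_sizeCode k) (nat_add.comp hb (.const 4))) (.const 3))
  refine decidableFor_of_forall (test := fun c w => ¬ AcceptsCode c w ∨ w.length ≤ b c)
    (primrecRel_acceptsCode.not.or hlen) hbound fun A hA => ?_
  simp only [acceptsCode_iff, sizeCode_code]
  rw [finite_language_iff hA (b := b A.code) (by rw [hb', sizeCode_code])]
  refine forall₂_congr fun w _ => ?_
  rw [← imp_iff_not_or]
  exact ⟨fun h _ => h, fun h hw => h (mem_alphabet_of_mem_language hw) hw⟩

theorem decidableFor₂_subset :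
    DecidableFor₂ (revPWK fun _ => k) fun A B => A.language ⊆ B.language := by
  refine decidableFor₂_of_forall (test := fun c w => ¬ AcceptsCode c.1 w ∨ AcceptsCode c.2 w)
    (bound := fun c => inclusionBound k (sizeCode k c.1) (sizeCode k c.2)) ?_ ?_ ?_
  · exact (primrecRel_acceptsCode.comp (fst.comp fst) snd).not.or
      (primrecRel_acceptsCode.comp (snd.comp fst) snd)
  · have h₁ : Primrec fun c : SystemCode × SystemCode => sizeCode k c.1 :=
      (primrec_sizeCode k).comp fst
    have h₂ : Primrec fun c : SystemCode × SystemCode => sizeCode k c.2 :=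
      (primrec_sizeCode k).comp snd
    exact nat_add.comp ((primrec_walkBound _).comp (nat_mul.comp (nat_mul.comp h₁ h₂) (.const 3)))
      ((primrec_walkBound _).comp (nat_mul.comp (nat_mul.comp h₁ (.const (1 + 1))) (.const 3)))
  · intro A hA B hB
    simp only [acceptsCode_iff, sizeCode_code]
    rw [language_subset_iff hA hB]
    refine forall₂_congr fun w _ => ?_
    rw [← imp_iff_not_or]
    exact ⟨fun h _ => h, fun h hw => h (mem_alphabet_of_mem_language hw) hw⟩

theorem DecidableFor₂.antisymm {C : Set System} (h : DecidableFor₂ C fun A B =>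
    A.language ⊆ B.language) : DecidableFor₂ C fun A B => A.language = B.language := by
  obtain ⟨f, hf, h⟩ := decidableFor₂_iff.1 h
  refine decidableFor₂_iff.2 ⟨fun c => f c && f (c.2, c.1),
    (Primrec.and.to_comp).comp hf (hf.comp (Computable.snd.pair Computable.fst)),
    fun A hA B hB => ?_⟩
  rw [Bool.and_eq_true, h A hA B hB, h B hB A hA, ← Set.Subset.antisymm_iff]

end System

end WatsonCrick

theorem mainTheorem10 (k : ℕ) :
    WatsonCrick.System.DecidableFor (WatsonCrick.System.revPWK fun _ => k)
      (fun A => A.language = ∅) ∧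
    WatsonCrick.System.DecidableFor (WatsonCrick.System.revPWK fun _ => k)
      (fun A => A.language.Finite) ∧
    WatsonCrick.System.DecidableFor₂ (WatsonCrick.System.revPWK fun _ => k)
      (fun A B => A.language ⊆ B.language) ∧
    WatsonCrick.System.DecidableFor₂ (WatsonCrick.System.revPWK fun _ => k)
      (fun A B => A.language = B.language) :=
  ⟨WatsonCrick.System.decidableFor_empty k, WatsonCrick.System.decidableFor_finite k,
    WatsonCrick.System.decidableFor₂_subset k,
    (WatsonCrick.System.decidableFor₂_subset k).antisymm⟩
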